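/- For $n\ge 0$ let $\widetilde S_n$ be the double cover of the symmetric group $S_n$ generated by $z,t_1,\dots,t_{n-1}$ with relations: $z$ central, $z^2=1$, $t_i^2=z$, $t_it_{i+1}t_i=t_{i+1}t_it_{i+1}$, and $t_jt_i=zt_it_j$ for $|i-j|>1$. Let $\theta:\widetilde S_n\to S_n$ be the projection $z\mapsto 1$, $t_i\mapsto (i,i+1)$, and let $\widetilde S_\infty=\bigcup_n\widetilde S_n$. For $1\le i\le n$ put $x_i=t_it_{i+1}\cdots t_{n-1}t_nt_{n-1}\cdots t_i\in\widetilde S_{n+1}$, and for distinct $i_1,\dots,i_m\in\{1,\dots,n\}$ put $[i_1,\dots,i_m]=x_{i_1}x_{i_m}x_{i_{m-1}}\cdots x_{i_2}x_{i_1}$ if $m>1$ and $[i_1]=z$; these elements lie in $\widetilde S_n$. Let $\mathcal{EP}$ be the set of partitions $\lambda=(\lambda_1\ge\dots\ge\lambda_\ell>0)$ all of whose parts are even, with $|\lambda|=\sum_i\lambda_i$ and $\ell(\lambda)=\ell$. For $\lambda\in\mathcal{EP}$ let $D_\lambda(n)$ be the conjugacy class in $\widetilde S_n$ of $$t_\lambda=[1,\dots,\lambda_1+1]\,[\lambda_1+2,\dots,\lambda_1+\lambda_2+2]\cdots[\lambda_1+\dots+\lambda_{\ell-1}+\ell,\dots,\lambda_1+\dots+\lambda_\ell+\ell]$$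 if $|\lambda|+\ell(\lambda)\le n$, and $D_\lambda(n)=\emptyset$ otherwise; let $D_\lambda=\bigcup_nD_\lambda(n)\subset\widetilde S_\infty$. For a commutative ring $R$ without $2$-torsion let $RS_n^-=R\widetilde S_n/\langle z+1\rangle$, a superalgebra in which the $t_i$ are odd, let $\mathcal Z_n$ be the set of its even central elements, and let $d_\lambda(n)\in RS_n^-$ be the image of the sum of the elements of $D_\lambda(n)$. The $d_\lambda(n)$ with $\lambda\in\mathcal{EP}$, $|\lambda|+\ell(\lambda)\le n$, form an $R$-basis of $\mathcal Z_n$, and there are integers $a_{\lambda\mu}^\nu(n)$, independent of $R$, such that $$d_\lambda(n)\,d_\mu(n)=\sum_{\nu\in\mathcal{EP}}a_{\lambda\mu}^\nu(n)\,d_\nu(n)$$ for all $R$, $n$ and $\lambda,\mu\in\mathcal{EP}$ (they are determined for $n\ge|\nu|+\ell(\nu)$). Theorem. Let $\lambda,\mu,\nu\in\mathcal{EP}$. 1. There is a unique polynomial $f_{\lambda\mu}^\nu(x)\in\mathbb Q[x]$ such that $a_{\lambda\mu}^\nu(n)=f_{\lambda\mu}^\nu(n)$ for all integers $n\ge|\nu|+\ell(\nu)$.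 Its degree is at most the maximum of $|\mathbb N(a,b)|-|\nu|-\ell(\nu)$ over all pairs $(a,b)\in D_\lambda\times D_\mu$ with $ab\in D_\nu$ or $ab\in zD_\nu$, where $\mathbb N(a,b)$ is the set of positive integers moved by $\theta(a)$ or $\theta(b)$; if there is no such pair, $f_{\lambda\mu}^\nu=0$. 2. $f_{\lambda\mu}^\nu=0$ unless $|\nu|\le|\lambda|+|\mu|$. 3. If $|\nu|=|\lambda|+|\mu|$, then $f_{\lambda\mu}^\nu$ is constant, i.e. $a_{\lambda\mu}^\nu(n)$ is independent of $n$ for $n\ge|\nu|+\ell(\nu)$. -/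

import Mathlib

open Polynomial

namespace SpinFH

/-! ## Even partitions -/

/-- A partition all of whose parts are even: a non-increasing finite sequence of positive even
integers. -/
structure EvenPartition where
  parts : List ℕ
  sorted : parts.Pairwise (· ≥ ·)
  pos : ∀ i ∈ parts, 0 < i
  even : ∀ i ∈ parts, Even i

namespace EvenPartition

/-- `|la|`, the sum of the parts. -/
def size (la : EvenPartition) : ℕ := la.parts.sum

/-- `ℓ(la)`, the number of parts. -/
def length (la : EvenPartition) : ℕ := la.parts.length

end EvenPartition

/-! ## The double covers of the symmetric groups, for finite `n` and for `n = ∞` -/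

/-- Generators of the double cover of `S_n`: a letter `z`, and a letter `t i` for each
`1 ≤ i ≤ n - 1` (for each `i ≥ 1` if `n = ∞`). -/
inductive Gen (n : ℕ∞) : Type
  | z : Gen n
  | t (i : ℕ) (h : 1 ≤ i ∧ (i : ℕ∞) < n) : Gen n

open FreeGroup in
/-- The relators: `z` is central, `z² = 1`, `tᵢ² = z`, `tᵢ tᵢ₊₁ tᵢ = tᵢ₊₁ tᵢ tᵢ₊₁`, and
`tⱼ tᵢ = z tᵢ tⱼ` for `|i - j| > 1`. -/
inductive Rel (n : ℕ∞) : FreeGroup (Gen n) → Prop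
  | central (i : ℕ) (hi : 1 ≤ i ∧ (i : ℕ∞) < n) :
      Rel n ((of .z * of (.t i hi)) * (of (.t i hi) * of .z)⁻¹)
  | z_sq : Rel n (of .z ^ 2)
  | t_sq (i : ℕ) (hi : 1 ≤ i ∧ (i : ℕ∞) < n) : Rel n (of (.t i hi) ^ 2 * (of .z)⁻¹)
  | braid (i : ℕ) (hi : 1 ≤ i ∧ (i : ℕ∞) < n) (hj : 1 ≤ i + 1 ∧ ((i + 1 : ℕ) : ℕ∞) < n) :
      Rel n ((of (.t i hi) * of (.t (i + 1) hj) * of (.t i hi)) *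
        (of (.t (i + 1) hj) * of (.t i hi) * of (.t (i + 1) hj))⁻¹)
  | far (i j : ℕ) (hi : 1 ≤ i ∧ (i : ℕ∞) < n) (hj : 1 ≤ j ∧ (j : ℕ∞) < n)
      (hij : i + 1 < j ∨ j + 1 < i) :
      Rel n ((of (.t j hj) * of (.t i hi)) * (of .z * of (.t i hi) * of (.t j hj))⁻¹)

/-- The double cover of the symmetric group `S_n`. For `n = ∞` this is the union of the finite
ones, presented by all the generators. -/
abbrev Cover (n : ℕ∞) : Type := PresentedGroup {r | Rel n r}

/-- The central element `z`. -/
def z (n : ℕ∞) : Cover n := PresentedGroup.of Gen.z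

open Classical in
/-- The generator `tᵢ`, for `1 ≤ i ≤ n - 1` (it is only used for such `i`). -/
noncomputable def t (n : ℕ∞) (i : ℕ) : Cover n :=
  if h : 1 ≤ i ∧ (i : ℕ∞) < n then PresentedGroup.of (Gen.t i h) else 1

/-- The image of a generator under the projection onto permutations of `1, 2, 3, …` (extended to
`ℕ` by fixing `0`): `z ↦ 1`, `tᵢ ↦ (i, i + 1)`. -/
def genPerm (n : ℕ∞) : Gen n → Equiv.Perm ℕ
  | .z => 1
  | .t i _ => Equiv.swap i (i + 1)

theorem genPerm_rel (n : ℕ∞) : ∀ r ∈ {r | Rel n r}, FreeGroup.lift (genPerm n) r = 1 := by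
  rintro r (⟨i, hi⟩ | _ | ⟨i, hi⟩ | ⟨i, hi, hj⟩ | ⟨i, j, hi, hj, hij⟩)
  · simp [genPerm]
  · simp [genPerm]
  · simp [genPerm, pow_two]
  · simp only [map_mul, map_inv, FreeGroup.lift_apply_of, genPerm]
    rw [mul_inv_eq_one, Equiv.swap_mul_swap_mul_swap (by omega) (by omega),
      Equiv.swap_comm i (i + 1), Equiv.swap_comm (i + 1) (i + 1 + 1),
      Equiv.swap_mul_swap_mul_swap (by omega) (by omega), Equiv.swap_comm]
  · simp only [map_mul, map_inv, FreeGroup.lift_apply_of, genPerm, one_mul]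
    rw [mul_inv_eq_one]
    refine (Equiv.Perm.Disjoint.commute ?_).eq
    intro x
    by_cases hx : x = j ∨ x = j + 1
    · right
      apply Equiv.swap_apply_of_ne_of_ne <;> omega
    · left
      apply Equiv.swap_apply_of_ne_of_ne <;> omega

/-- The projection `θ` of the double cover onto the symmetric group, whose elements are viewed as
permutations of `ℕ` that move only elements of `{1, …, n}`. -/
def theta (n : ℕ∞) : Cover n →* Equiv.Perm ℕ := PresentedGroup.toGroup (genPerm_rel n)

/-- Degrees of the generators in `ℤ/2`: `z` is even, each `tᵢ` is odd. -/
def genParity (n : ℕ∞) : Gen n → Multiplicative (ZMod 2)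
  | .z => 1
  | .t _ _ => Multiplicative.ofAdd 1

theorem genParity_rel (n : ℕ∞) : ∀ r ∈ {r | Rel n r}, FreeGroup.lift (genParity n) r = 1 := by
  rintro r (⟨i, hi⟩ | _ | ⟨i, hi⟩ | ⟨i, hi, hj⟩ | ⟨i, j, hi, hj, hij⟩) <;>
    simp only [map_mul, map_inv, map_pow, FreeGroup.lift_apply_of, genParity] <;> decide

/-- The degree homomorphism to `ℤ/2`. -/
def parity (n : ℕ∞) : Cover n →* Multiplicative (ZMod 2) :=
  PresentedGroup.toGroup (genParity_rel n)

/-- The images of the generators under the embedding of the `n`-th cover in the `m`-th. -/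
def genEmb {n m : ℕ∞} (h : n ≤ m) : Gen n → Cover m
  | .z => PresentedGroup.of Gen.z
  | .t i hi => PresentedGroup.of (Gen.t i ⟨hi.1, hi.2.trans_le h⟩)

theorem genEmb_eq {n m : ℕ∞} (h : n ≤ m) (r : FreeGroup (Gen n)) :
    FreeGroup.lift (genEmb h) r = PresentedGroup.mk {r | Rel m r}
      (FreeGroup.map (fun g : Gen n => match g with
        | .z => Gen.z
        | .t i hi => Gen.t i ⟨hi.1, hi.2.trans_le h⟩) r) := by
  rw [← MonoidHom.comp_apply (PresentedGroup.mk {r | Rel m r})]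
  congr 1
  ext g
  cases g <;> simp [genEmb, PresentedGroup.of]

theorem genEmb_rel {n m : ℕ∞} (h : n ≤ m) :
    ∀ r ∈ {r | Rel n r}, FreeGroup.lift (genEmb h) r = 1 := by
  intro r hr
  rw [genEmb_eq]
  refine PresentedGroup.one_of_mem ?_
  rcases hr with ⟨i, hi⟩ | _ | ⟨i, hi⟩ | ⟨i, hi, hj⟩ | ⟨i, j, hi, hj, hij⟩ <;>
    simp only [map_mul, map_inv, map_pow, FreeGroup.map.of]
  · exact Rel.central i _
  · exact Rel.z_sq
  · exact Rel.t_sq i _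
  · exact Rel.braid i _ _
  · exact Rel.far i j _ _ hij

/-- The natural embedding of the `n`-th cover in the `m`-th, for `n ≤ m ≤ ∞`. -/
def emb {n m : ℕ∞} (h : n ≤ m) : Cover n →* Cover m := PresentedGroup.toGroup (genEmb_rel h)

/-! ## Cycles and even split conjugacy classes -/

/-- `xᵢ = tᵢ tᵢ₊₁ ⋯ tₙ₋₁ tₙ tₙ₋₁ ⋯ tᵢ₊₁ tᵢ` in the `(n + 1)`-st cover, for `1 ≤ i ≤ n`. -/
noncomputable def x (n i : ℕ) : Cover (n + 1 : ℕ) :=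
  ((List.range' i (n - i)).map (t (n + 1 : ℕ))).prod * t (n + 1 : ℕ) n *
    ((List.range' i (n - i)).reverse.map (t (n + 1 : ℕ))).prod

/-- The cycle `[i₁, …, iₘ]` on distinct elements of `{1, …, n}`: it is `z` for `m = 1` and
`x_{i₁} x_{iₘ} x_{iₘ₋₁} ⋯ x_{i₂} x_{i₁}` for `m > 1` (the empty list is never used). -/
noncomputable def cycle (n : ℕ) : List ℕ → Cover (n + 1 : ℕ)
  | [] => 1
  | [_] => z (n + 1 : ℕ)
  | i :: j :: l => x n i * ((j :: l).reverse.map (x n)).prod * x n i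

/-- The product of the cycles `[s, …, s + p₁] [s + p₁ + 1, …, s + p₁ + p₂ + 1] ⋯` of lengths
`p₁ + 1, p₂ + 1, …` on consecutive integers, starting at `s`. -/
noncomputable def cyclesFrom (n : ℕ) : ℕ → List ℕ → Cover (n + 1 : ℕ)
  | _, [] => 1
  | s, p :: l => cycle n (List.range' s (p + 1)) * cyclesFrom n (s + p + 1) l

/-- The distinguished element
`t_la = [1, …, la₁ + 1] [la₁ + 2, …, la₁ + la₂ + 2] ⋯` of modified type `la`. -/
noncomputable def tElem (n : ℕ) (la : EvenPartition) : Cover (n + 1 : ℕ) :=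
  cyclesFrom n 1 la.parts

/-- The even split conjugacy class `D_la(n)` of the `n`-th cover: the class of `t_la` if
`|la| + ℓ(la) ≤ n`, and empty otherwise. The element `t_la` is written through elements of the
`(n + 1)`-st cover but lies in the `n`-th. -/
def D (n : ℕ) (la : EvenPartition) : Set (Cover n) :=
  {g | la.size + la.length ≤ n ∧
    ∃ s : Cover n, emb (by exact_mod_cast n.le_succ) s = tElem n la ∧ IsConj s g}

/-- `D_la`, the union of the classes `D_la(n)` inside the infinite cover. -/
def DInf (la : EvenPartition) : Set (Cover ⊤) :=
  ⋃ n : ℕ, emb (le_top : (n : ℕ∞) ≤ ⊤) '' D n la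

/-- `ℕ(a, b)`, the set of points moved by `θ(a)` or by `θ(b)`. -/
def moved (a b : Cover ⊤) : Set ℕ := {j | theta ⊤ a j ≠ j ∨ theta ⊤ b j ≠ j}

/-- The pairs `(a, b)` with `a ∈ D_la`, `b ∈ D_mu` and `ab ∈ D_nu` or `ab ∈ z D_nu`. -/
def pairs (la mu nu : EvenPartition) : Set (Cover ⊤ × Cover ⊤) :=
  {p | p.1 ∈ DInf la ∧ p.2 ∈ DInf mu ∧
    (p.1 * p.2 ∈ DInf nu ∨ p.1 * p.2 ∈ (fun g => z ⊤ * g) '' DInf nu)}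

/-! ## The spin group algebra and its even center -/

/-- The relation `z = -1` in the group algebra of the `n`-th cover. -/
inductive AlgRel (R : Type*) [CommRing R] (n : ℕ) :
    MonoidAlgebra R (Cover n) → MonoidAlgebra R (Cover n) → Prop
  | z_eq : AlgRel R n (MonoidAlgebra.of R (Cover n) (z n)) (-1)

/-- The spin group algebra `R S_n⁻`: the group algebra of the `n`-th cover modulo the two-sided
ideal generated by `z + 1`. -/
abbrev SpinAlg (R : Type*) [CommRing R] (n : ℕ) : Type _ := RingQuot (AlgRel R n)

/-- The quotient map onto the spin group algebra. -/
noncomputable def proj (R : Type*) [CommRing R] (n : ℕ) :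
    MonoidAlgebra R (Cover n) →ₐ[R] SpinAlg R n := RingQuot.mkAlgHom R (AlgRel R n)

/-- The even part of the superalgebra `R S_n⁻`, in which the `tᵢ` are odd: the span of the images
of the even elements of the `n`-th cover. -/
noncomputable def evenPart (R : Type*) [CommRing R] (n : ℕ) : Submodule R (SpinAlg R n) :=
  Submodule.span R {y | ∃ g : Cover n, parity n g = 1 ∧ y = proj R n (MonoidAlgebra.of R _ g)}

/-- The even center: the even central elements of `R S_n⁻`. -/
noncomputable def evenCenter (R : Type*) [CommRing R] (n : ℕ) : Submodule R (SpinAlg R n) :=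
  Subalgebra.toSubmodule (Subalgebra.center R (SpinAlg R n)) ⊓ evenPart R n

/-- `d_la(n)`, the image in `R S_n⁻` of the class sum of `D_la(n)` (a finite sum, since the
`n`-th cover is finite); it is `0` if `|la| + ℓ(la) > n`. -/
noncomputable def d (R : Type*) [CommRing R] (n : ℕ) (la : EvenPartition) : SpinAlg R n :=
  proj R n (∑ᶠ g ∈ D n la, MonoidAlgebra.of R (Cover n) g)

/-- The `d_la(n)` with `|la| + ℓ(la) ≤ n` form an `R`-basis of the even center. -/
def ClassSumsFormBasis (R : Type*) [CommRing R] (n : ℕ) : Prop :=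
  LinearIndependent R
      (fun la : {la : EvenPartition // la.size + la.length ≤ n} => d R n la.1) ∧
    Submodule.span R
      (Set.range (fun la : {la : EvenPartition // la.size + la.length ≤ n} => d R n la.1)) =
      evenCenter R n

/-- The integers `a la mu nu n` are structure constants for the class sums in all the even
centers over `R`: `d_la(n) d_mu(n) = ∑ a la mu nu n • d_nu(n)`, the sum over all even partitions
`nu`. Only finitely many `d_nu(n)` are nonzero, and `a la mu nu n` is unconstrained for
`n < |nu| + ℓ(nu)`. -/
def IsStructureConstants (R : Type*) [CommRing R]
    (a : EvenPartition → EvenPartition → EvenPartition → ℕ → ℤ) : Prop :=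
  ∀ (la mu : EvenPartition) (n : ℕ),
    d R n la * d R n mu = ∑ᶠ nu : EvenPartition, (a la mu nu n : R) • d R n nu

end SpinFH

namespace SpinFH

/-! ## First properties of the covers -/

/-! Basis and structure constants. The kernel of `theta` is exactly `{1, z}`: coset enumeration
bounds it, and a Clifford algebra in which `z` acts as `-1` shows `z ≠ 1`. An even central element
of the spin algebra is then a class function on the cover that changes sign under `z` and vanishes
on odd elements. Lifts of disjoint permutations commute up to the superalgebra sign
(`superComm_of_disjoint`), so an even `g` with a cycle of even length is conjugate to `z g`, and its
coefficient vanishes when there is no 2-torsion. If all cycles of `g` are odd, exactly one of `g`,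
`z g` has odd order (`odd_orderOf_z_mul`). Hence cycle type and parity of the order together cut out
the classes `D n la` (`mem_D_iff`), uniformly in `n`. It follows that the class sums form a basis,
and the structure constant at `g ∈ D n nu` is the number of factorizations of `g` minus the number
of factorizations of `z g`, an integer that does not see `R`.

Polynomiality follows the Farahat–Higman argument. Put `N = |nu| + ℓ(nu)` and take `c ∈ D N nu`,
which moves all of `1, …, N`. Sort the factorizations `c = a b` by the set `U ⊇ {1, …, N}` of points
moved by `a` or `b`. A lift of a permutation of the points beyond `N` commutes with `c` because `c`
is even, so conjugation by it shows that the number of factorizations depends only on the size of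
`U`. Doing the same for `z c` gives the constant as a sum over `k` of `(n - N).choose k` times a
signed weight independent of `n`, with finitely many nonzero weights (`structureConst_eq_sum`). The
degree bound is read off from these `k`.

For the bounds on `|nu|`: `|la|` is the rank (moved points minus nontrivial cycles) of an element of
type `la`, and rank is subadditive. When equality holds, a point fixed by `a b` is fixed by both `a`
and `b`, so `U = {1, …, N}` and only `k = 0` survives (`rank_mul_le`, `factorization_bounds`). -/

theorem t_eq_of {n : ℕ∞} {i : ℕ} (h : 1 ≤ i ∧ (i : ℕ∞) < n) :
    t n i = PresentedGroup.of (Gen.t i h) := by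
  unfold t; rw [dif_pos h]

/-- To prove a subgroup is everything, check `z` and the `tᵢ`. -/
theorem mem_of_gens {n : ℕ∞} (H : Subgroup (Cover n)) (hz : z n ∈ H)
    (ht : ∀ i : ℕ, 1 ≤ i ∧ (i : ℕ∞) < n → t n i ∈ H) (g : Cover n) : g ∈ H := by
  refine PresentedGroup.generated_by _ H (fun j => ?_) g
  cases j with
  | z => exact hz
  | t i h => rw [← t_eq_of]; exact ht i h

theorem z_mul_t {n : ℕ∞} {i : ℕ} (h : 1 ≤ i ∧ (i : ℕ∞) < n) : z n * t n i = t n i * z n := by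
  rw [t_eq_of h]
  exact PresentedGroup.mk_eq_mk_of_mul_inv_mem (rels := {r | Rel n r}) (Rel.central i h)

theorem z_sq (n : ℕ∞) : z n * z n = 1 := by
  rw [← pow_two]
  exact PresentedGroup.one_of_mem (rels := {r | Rel n r}) Rel.z_sq

theorem t_mul_self {n : ℕ∞} {i : ℕ} (h : 1 ≤ i ∧ (i : ℕ∞) < n) : t n i * t n i = z n := by
  rw [t_eq_of h, ← pow_two]
  exact PresentedGroup.mk_eq_mk_of_mul_inv_mem (rels := {r | Rel n r}) (Rel.t_sq i h)

theorem t_braid {n : ℕ∞} {i : ℕ} (h : 1 ≤ i) (h' : ((i + 1 : ℕ) : ℕ∞) < n) :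
    t n i * t n (i + 1) * t n i = t n (i + 1) * t n i * t n (i + 1) := by
  have hi : 1 ≤ i ∧ (i : ℕ∞) < n := ⟨h, lt_trans (by exact_mod_cast Nat.lt_succ_self i) h'⟩
  rw [t_eq_of hi, t_eq_of ⟨by omega, h'⟩]
  exact PresentedGroup.mk_eq_mk_of_mul_inv_mem (rels := {r | Rel n r}) (Rel.braid i hi ⟨by omega, h'⟩)

theorem t_far {n : ℕ∞} {i j : ℕ} (hi : 1 ≤ i ∧ (i : ℕ∞) < n) (hj : 1 ≤ j ∧ (j : ℕ∞) < n)
    (hij : i + 1 < j ∨ j + 1 < i) : t n j * t n i = z n * t n i * t n j := by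
  rw [t_eq_of hi, t_eq_of hj]
  exact PresentedGroup.mk_eq_mk_of_mul_inv_mem (rels := {r | Rel n r}) (Rel.far i j hi hj hij)

theorem z_comm {n : ℕ∞} (g : Cover n) : z n * g = g * z n := by
  have : g ∈ Subgroup.centralizer {z n} := by
    refine mem_of_gens _ ?_ (fun i hi => ?_) g
    · rw [Subgroup.mem_centralizer_singleton_iff]
    · rw [Subgroup.mem_centralizer_singleton_iff, z_mul_t hi]
  rw [Subgroup.mem_centralizer_singleton_iff] at this
  exact this.symm

theorem z_inv (n : ℕ∞) : (z n)⁻¹ = z n := inv_eq_of_mul_eq_one_left (z_sq n)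

theorem z_mul_z_mul {n : ℕ∞} (g : Cover n) : z n * (z n * g) = g := by
  rw [← mul_assoc, z_sq, one_mul]

theorem mul_z_mul {n : ℕ∞} (g h : Cover n) : g * (z n * h) = z n * (g * h) := by
  rw [← mul_assoc, ← z_comm, mul_assoc]

theorem t_inv {n : ℕ∞} {i : ℕ} (h : 1 ≤ i ∧ (i : ℕ∞) < n) : (t n i)⁻¹ = z n * t n i := by
  rw [inv_eq_iff_mul_eq_one, mul_z_mul, t_mul_self h, z_sq]

/-! ### The homomorphisms on generators -/

@[simp] theorem theta_z (n : ℕ∞) : theta n (z n) = 1 := PresentedGroup.toGroup.of _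

theorem theta_t {n : ℕ∞} {i : ℕ} (h : 1 ≤ i ∧ (i : ℕ∞) < n) :
    theta n (t n i) = Equiv.swap i (i + 1) := by
  rw [t_eq_of h]; exact PresentedGroup.toGroup.of _

@[simp] theorem parity_z (n : ℕ∞) : parity n (z n) = 1 := PresentedGroup.toGroup.of _

theorem parity_t {n : ℕ∞} {i : ℕ} (h : 1 ≤ i ∧ (i : ℕ∞) < n) :
    parity n (t n i) = Multiplicative.ofAdd 1 := by
  rw [t_eq_of h]; exact PresentedGroup.toGroup.of _

@[simp] theorem emb_z {n m : ℕ∞} (h : n ≤ m) : emb h (z n) = z m := PresentedGroup.toGroup.of _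

theorem emb_t {n m : ℕ∞} (h : n ≤ m) {i : ℕ} (hi : 1 ≤ i ∧ (i : ℕ∞) < n) :
    emb h (t n i) = t m i := by
  rw [t_eq_of hi, t_eq_of ⟨hi.1, hi.2.trans_le h⟩]; exact PresentedGroup.toGroup.of _

theorem hom_eq_of_gens {n : ℕ∞} {H : Type*} [Group H] {f g : Cover n →* H} (hz : f (z n) = g (z n))
    (ht : ∀ i : ℕ, 1 ≤ i ∧ (i : ℕ∞) < n → f (t n i) = g (t n i)) : f = g := by
  refine DFunLike.ext _ _ fun x => ?_
  exact mem_of_gens (f.eqLocus g) hz ht x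

theorem theta_emb {n m : ℕ∞} (h : n ≤ m) (g : Cover n) : theta m (emb h g) = theta n g := by
  have : (theta m).comp (emb h) = theta n := by
    refine hom_eq_of_gens (by simp) fun i hi => ?_
    rw [MonoidHom.comp_apply, emb_t h hi, theta_t hi, theta_t ⟨hi.1, hi.2.trans_le h⟩]
  exact DFunLike.congr_fun this g

theorem emb_emb {n m k : ℕ∞} (h : n ≤ m) (h' : m ≤ k) (g : Cover n) :
    emb h' (emb h g) = emb (h.trans h') g := by
  have : (emb h').comp (emb h) = emb (h.trans h') := by
    refine hom_eq_of_gens (by simp) fun i hi => ?_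
    rw [MonoidHom.comp_apply, emb_t h hi, emb_t _ hi, emb_t _ ⟨hi.1, hi.2.trans_le h⟩]
  exact DFunLike.congr_fun this g

/-! ### The element `z` is not trivial -/

/-- The negative definite quadratic form `- ∑ vᵢ²`. -/
noncomputable def negForm : QuadraticForm ℝ (ℕ →₀ ℝ) :=
  LinearMap.BilinMap.toQuadraticMap
    (-(Finsupp.linearCombination ℝ (fun i : ℕ => Finsupp.lapply (R := ℝ) (M := ℝ) i) :
      (ℕ →₀ ℝ) →ₗ[ℝ] (ℕ →₀ ℝ) →ₗ[ℝ] ℝ))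

theorem negForm_apply (v : ℕ →₀ ℝ) : negForm v = - v.sum fun i r => r * v i := by
  simp [negForm, Finsupp.linearCombination_apply, Finsupp.sum, LinearMap.sum_apply]

/-- The unnormalized roots `eᵢ - eᵢ₊₁`. -/
noncomputable def root (i : ℕ) : ℕ →₀ ℝ := Finsupp.single i 1 - Finsupp.single (i + 1) 1

theorem polar_negForm (v w : ℕ →₀ ℝ) :
    QuadraticMap.polar negForm v w = - (v.sum fun i r => r * w i) - (w.sum fun i r => r * v i) := by
  rw [negForm, LinearMap.BilinMap.polar_toQuadraticMap]
  simp [Finsupp.linearCombination_apply, Finsupp.sum, LinearMap.sum_apply]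
  ring

theorem sum_root (i : ℕ) (w : ℕ →₀ ℝ) : ((root i).sum fun i r => r * w i) = w i - w (i + 1) := by
  rw [root, Finsupp.sum_sub_index (by intros; ring)]
  simp

/-- The image of `tᵢ` in the Clifford algebra. -/
noncomputable def cliff (i : ℕ) : CliffordAlgebra negForm :=
  (√2)⁻¹ • CliffordAlgebra.ι negForm (root i)

theorem cliff_mul_cliff (i j : ℕ) : cliff i * cliff j =
    (2 : ℝ)⁻¹ • (CliffordAlgebra.ι negForm (root i) * CliffordAlgebra.ι negForm (root j)) := by
  rw [cliff, cliff, smul_mul_smul_comm, ← mul_inv, Real.mul_self_sqrt (by norm_num)]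

theorem cliff_sq (i : ℕ) : cliff i * cliff i = -1 := by
  rw [cliff_mul_cliff, CliffordAlgebra.ι_sq_scalar, negForm_apply, sum_root]
  rw [Algebra.algebraMap_eq_smul_one, smul_smul]
  simp [root]
  norm_num

theorem cliff_anticomm (i j : ℕ) : cliff i * cliff j + cliff j * cliff i =
    ((2 : ℝ)⁻¹ * - (2 * (root j i - root j (i + 1)))) • 1 := by
  rw [cliff_mul_cliff, cliff_mul_cliff, ← smul_add, CliffordAlgebra.ι_mul_ι_add_swap, polar_negForm,
    sum_root, sum_root, Algebra.algebraMap_eq_smul_one, smul_smul]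
  congr 2
  simp only [root, Finsupp.sub_apply, Finsupp.single_apply]
  grind

theorem cliff_far {i j : ℕ} (hij : i + 1 < j ∨ j + 1 < i) : cliff j * cliff i = - (cliff i * cliff j) := by
  have := cliff_anticomm j i
  have h0 : root i j = 0 ∧ root i (j + 1) = 0 := by
    simp only [root, Finsupp.sub_apply, Finsupp.single_apply]
    grind
  rw [eq_neg_iff_add_eq_zero, this, h0.1, h0.2]
  simp

/-- Adjacent normalized roots have anticommutator `1` and each squares to `-1`, so both sides equal
`cliff i + cliff (i + 1)`. -/
theorem cliff_braid (i : ℕ) :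
    cliff i * cliff (i + 1) * cliff i = cliff (i + 1) * cliff i * cliff (i + 1) := by
  have h : cliff i * cliff (i + 1) + cliff (i + 1) * cliff i = 1 := by
    rw [cliff_anticomm]
    have : i + 1 + 1 ≠ i := by omega
    simp [root, this]
  have h1 : cliff i * cliff (i + 1) = 1 - cliff (i + 1) * cliff i := eq_sub_of_add_eq h
  rw [h1, sub_mul, mul_assoc, cliff_sq, mul_assoc (cliff (i + 1)), h1, mul_sub, ← mul_assoc, cliff_sq]
  simp [add_comm]

/-- The units of the Clifford algebra which are the images of the generators. -/
noncomputable def cliffGen (n : ℕ∞) : Gen n → (CliffordAlgebra negForm)ˣ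
  | .z => -1
  | .t i _ => ⟨cliff i, -cliff i, by simp [cliff_sq], by simp [cliff_sq]⟩

theorem cliffGen_rel (n : ℕ∞) : ∀ r ∈ {r | Rel n r}, FreeGroup.lift (cliffGen n) r = 1 := by
  rintro r (⟨i, hi⟩ | _ | ⟨i, hi⟩ | ⟨i, hi, hj⟩ | ⟨i, j, hi, hj, hij⟩) <;>
    simp only [map_mul, map_inv, FreeGroup.lift_apply_of, cliffGen, mul_inv_eq_one,
      pow_two, Units.ext_iff, Units.val_mul, Units.val_neg, Units.val_one]
  · simp
  · simp
  · exact cliff_sq i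
  · exact cliff_braid i
  · rw [cliff_far hij]; simp

/-- The units `cliffGen` satisfy the defining relations and send `z` to `-1`, which differs from `1`
in a real Clifford algebra. -/
theorem z_ne_one (n : ℕ∞) : z n ≠ 1 := by
  intro h
  have h1 : PresentedGroup.toGroup (cliffGen_rel n) (z n) = -1 := PresentedGroup.toGroup.of _
  rw [h, map_one, Units.ext_iff] at h1
  have h2 : (1 : CliffordAlgebra negForm) + 1 = 0 := by
    nth_rewrite 1 [← Units.val_one, h1]; simp
  -- Invertibility of `2` gives nontriviality of the Clifford algebra, which the final `simp` needs.
  have : Invertible (2 : ℝ) := invertibleOfNonzero two_ne_zero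
  have h3 : algebraMap ℝ (CliffordAlgebra negForm) 2 = 0 := by
    rw [map_ofNat, ← h2]; norm_num
  rw [Algebra.algebraMap_eq_smul_one] at h3
  simp at h3

theorem z_mul_ne {n : ℕ∞} (g : Cover n) : z n * g ≠ g := by
  intro h; exact z_ne_one n (mul_eq_right.mp h)

/-! ## The kernel of the projection -/

/-- The subgroup generated by `z` and the `tᵢ` with `i < k`. -/
def lowSubgroup (n : ℕ∞) (k : ℕ) : Subgroup (Cover n) :=
  Subgroup.closure ({z n} ∪ {g | ∃ i, 1 ≤ i ∧ i < k ∧ (i : ℕ∞) < n ∧ g = t n i})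

theorem z_mem_low (n : ℕ∞) (k : ℕ) : z n ∈ lowSubgroup n k :=
  Subgroup.subset_closure (Or.inl rfl)

theorem t_mem_low {n : ℕ∞} {k i : ℕ} (h1 : 1 ≤ i) (h2 : i < k) (h3 : (i : ℕ∞) < n) :
    t n i ∈ lowSubgroup n k :=
  Subgroup.subset_closure (Or.inr ⟨i, h1, h2, h3, rfl⟩)

theorem low_mono (n : ℕ∞) {k l : ℕ} (h : k ≤ l) : lowSubgroup n k ≤ lowSubgroup n l := by
  refine Subgroup.closure_mono (Set.union_subset_union_right _ ?_)
  rintro g ⟨i, h1, h2, h3, rfl⟩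
  exact ⟨i, h1, by omega, h3, rfl⟩

theorem exists_mem_low {n : ℕ∞} (g : Cover n) : ∃ k, g ∈ lowSubgroup n k := by
  let H : Subgroup (Cover n) :=
    { carrier := {g | ∃ k, g ∈ lowSubgroup n k}
      one_mem' := ⟨0, one_mem _⟩
      inv_mem' := fun ⟨k, h⟩ => ⟨k, inv_mem h⟩
      mul_mem' := fun ⟨k, h⟩ ⟨l, h'⟩ => ⟨max k l, mul_mem (low_mono n (le_max_left _ _) h)
        (low_mono n (le_max_right _ _) h')⟩ }
  exact mem_of_gens H ⟨0, z_mem_low n 0⟩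
    (fun i hi => ⟨i + 1, t_mem_low hi.1 (by omega) hi.2⟩) g

theorem theta_low {n : ℕ∞} {k : ℕ} {g : Cover n} (hg : g ∈ lowSubgroup n k) {j : ℕ} (hj : k < j) :
    theta n g j = j := by
  have : lowSubgroup n k ≤ (MulAction.stabilizer (Equiv.Perm ℕ) j).comap (theta n) := by
    refine (Subgroup.closure_le _).2 ?_
    rintro g (rfl | ⟨i, h1, h2, h3, rfl⟩)
    · simp
    · simp only [Subgroup.coe_comap, Set.mem_preimage, SetLike.mem_coe, MulAction.mem_stabilizer_iff,
        theta_t ⟨h1, h3⟩, Equiv.Perm.smul_def]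
      exact Equiv.swap_apply_of_ne_of_ne (by omega) (by omega)
  exact this hg

/-- The coset representatives `tₖ tₖ₋₁ ⋯ tₖ₋d₊₁`. -/
noncomputable def cosetRep (n : ℕ∞) (k : ℕ) : ℕ → Cover n
  | 0 => 1
  | d + 1 => cosetRep n k d * t n (k - d)

section coset

variable {n : ℕ∞} {k : ℕ}

theorem nat_lt_of_le (hk : (k : ℕ∞) < n) {j : ℕ} (hj : j ≤ k) : (j : ℕ∞) < n :=
  lt_of_le_of_lt (by exact_mod_cast hj) hk

theorem cosetRep_mul_lt (hk : (k : ℕ∞) < n) (d : ℕ) {j : ℕ} (hj : 1 ≤ j) (hjd : j + d < k) :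
    ∃ h ∈ lowSubgroup n k, cosetRep n k d * t n j = h * cosetRep n k d := by
  induction d with
  | zero => exact ⟨t n j, t_mem_low hj (by omega) (nat_lt_of_le hk (by omega)), by simp [cosetRep]⟩
  | succ d ih =>
    obtain ⟨h, hh, e⟩ := ih (by omega)
    refine ⟨z n * h, mul_mem (z_mem_low n k) hh, ?_⟩
    rw [cosetRep, mul_assoc, t_far (i := j) ⟨hj, nat_lt_of_le hk (by omega)⟩
      ⟨by omega, nat_lt_of_le hk (by omega)⟩ (by omega), mul_assoc (z n), mul_z_mul, ← mul_assoc _ (t n j),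
      e, mul_assoc, mul_assoc]

theorem cosetRep_mul_gt (hk : (k : ℕ∞) < n) (d : ℕ) (hd : d ≤ k) {j : ℕ} (hj : j ≤ k)
    (hjd : k + 1 < j + d) : ∃ h ∈ lowSubgroup n k, cosetRep n k d * t n j = h * cosetRep n k d := by
  induction d with
  | zero => omega
  | succ e ih =>
    have hj0 : 1 ≤ j := by omega
    have hlt : ∀ {i}, i ≤ k → (i : ℕ∞) < n := fun h => nat_lt_of_le hk h
    by_cases h : k + 1 < j + e
    · obtain ⟨h, hh, e'⟩ := ih (by omega) h
      refine ⟨z n * h, mul_mem (z_mem_low n k) hh, ?_⟩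
      rw [cosetRep, mul_assoc, t_far (i := j) ⟨hj0, hlt hj⟩
        ⟨by omega, hlt (by omega)⟩ (by omega), mul_assoc (z n), mul_z_mul, ← mul_assoc _ (t n j),
        e', mul_assoc, mul_assoc]
    -- Here the representative ends in `t (i + 1) * t i` with `j = i + 1`. The braid relation turns
    -- the new letter into a `t i` on the left, and that letter is far from the remaining ones.
    · obtain ⟨f, rfl⟩ : ∃ f, e = f + 1 := ⟨e - 1, by omega⟩
      obtain ⟨i, rfl⟩ : ∃ i, j = i + 1 := ⟨j - 1, by omega⟩
      obtain ⟨h, hh, e'⟩ := cosetRep_mul_lt hk f (j := i) (by omega) (by omega)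
      refine ⟨h, hh, ?_⟩
      have h1 : k - f = i + 1 := by omega
      have h2 : k - (f + 1) = i := by omega
      rw [cosetRep, cosetRep, h1, h2, mul_assoc, mul_assoc, ← mul_assoc (t n (i + 1)),
        ← t_braid (by omega) (hlt hj), ← mul_assoc, ← mul_assoc, e']
      simp only [mul_assoc]

theorem cosetRep_mul_t (hk : (k : ℕ∞) < n) (d : ℕ) (hd : d ≤ k) {j : ℕ} (hj0 : 1 ≤ j) (hj : j ≤ k) :
    ∃ h ∈ lowSubgroup n k, ∃ d' ≤ k, cosetRep n k d * t n j = h * cosetRep n k d' := by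
  rcases lt_trichotomy (j + d) k with h | h | h
  · obtain ⟨h, hh, e⟩ := cosetRep_mul_lt hk d hj0 h
    exact ⟨h, hh, d, hd, e⟩
  · refine ⟨1, one_mem _, d + 1, by omega, ?_⟩
    rw [cosetRep, one_mul, show k - d = j by omega]
  · by_cases h' : j + d = k + 1
    · obtain ⟨e, rfl⟩ : ∃ e, d = e + 1 := ⟨d - 1, by omega⟩
      refine ⟨z n, z_mem_low n k, e, by omega, ?_⟩
      rw [cosetRep, show k - e = j by omega, mul_assoc, t_mul_self ⟨hj0, nat_lt_of_le hk hj⟩, z_comm]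
    · obtain ⟨h, hh, e⟩ := cosetRep_mul_gt hk d hd hj (by omega)
      exact ⟨h, hh, d, hd, e⟩

/-- The union of the cosets of the `k + 1` representatives contains `1` and is stable under right
multiplication by the generators. Inverses cost nothing more, since `t⁻¹ = z t`. -/
theorem exists_cosetRep (hk : (k : ℕ∞) < n) {g : Cover n} (hg : g ∈ lowSubgroup n (k + 1)) :
    ∃ h ∈ lowSubgroup n k, ∃ d ≤ k, g = h * cosetRep n k d := by
  have key : ∀ y ∈ ({z n} ∪ {g | ∃ i, 1 ≤ i ∧ i < k + 1 ∧ (i : ℕ∞) < n ∧ g = t n i} : Set (Cover n)),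
      ∀ h ∈ lowSubgroup n k, ∀ d ≤ k, ∃ h' ∈ lowSubgroup n k, ∃ d' ≤ k,
        h * cosetRep n k d * y = h' * cosetRep n k d' := by
    rintro y (rfl | ⟨i, h1, h2, h3, rfl⟩) h hh d hd
    · exact ⟨z n * h, mul_mem (z_mem_low n k) hh, d, hd, by rw [← z_comm, mul_assoc]⟩
    · obtain ⟨h', hh', d', hd', e⟩ := cosetRep_mul_t hk d hd h1 (by omega)
      exact ⟨h * h', mul_mem hh hh', d', hd', by rw [mul_assoc, e, mul_assoc]⟩
  induction hg using Subgroup.closure_induction_right with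
  | one => exact ⟨1, one_mem _, 0, by omega, by simp [cosetRep]⟩
  | mul_right x _ y hy ih =>
    obtain ⟨h, hh, d, hd, rfl⟩ := ih
    exact key y hy h hh d hd
  | mul_inv_cancel x _ y hy ih =>
    obtain ⟨h, hh, d, hd, rfl⟩ := ih
    have : y⁻¹ = z n * y ∨ y⁻¹ = y := by
      rcases hy with rfl | ⟨i, h1, h2, h3, rfl⟩
      · right; exact z_inv n
      · left; exact t_inv ⟨h1, h3⟩
    rcases this with e | e
    · rw [e, mul_z_mul, ← mul_assoc, ← mul_assoc]
      exact key y hy (z n * h) (mul_mem (z_mem_low n k) hh) d hd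
    · rw [e]; exact key y hy h hh d hd

/-- The preimage of `k + 1` recovers `d`, so an element with trivial permutation can only have the
representative `d = 0`. -/
theorem theta_cosetRep (hk : (k : ℕ∞) < n) (d : ℕ) (hd : d ≤ k) :
    theta n (cosetRep n k d) (k + 1 - d) = k + 1 := by
  induction d with
  | zero => simp [cosetRep]
  | succ d ih =>
    rw [cosetRep, map_mul, Equiv.Perm.mul_apply,
      theta_t ⟨by omega, nat_lt_of_le hk (by omega)⟩, show k + 1 - (d + 1) = k - d by omega,
      Equiv.swap_apply_left, show k - d + 1 = k + 1 - d by omega]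
    exact ih (by omega)

end coset

theorem low_succ_le {n : ℕ∞} {k : ℕ} (h : ¬ (k : ℕ∞) < n) : lowSubgroup n (k + 1) ≤ lowSubgroup n k := by
  refine Subgroup.closure_mono (Set.union_subset_union_right _ ?_)
  rintro g ⟨i, h1, h2, h3, rfl⟩
  refine ⟨i, h1, ?_, h3, rfl⟩
  rcases Nat.lt_succ_iff_lt_or_eq.1 h2 with h2 | rfl
  · exact h2
  · exact absurd h3 h

/-- Descent on the number of generators needed: the coset representative of such a `g` must be
trivial, so `g` already lies in the next smaller subgroup, and the last one is generated by `z`. -/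
theorem eq_one_or_z_of_theta {n : ℕ∞} {g : Cover n} (hg : theta n g = 1) : g = 1 ∨ g = z n := by
  obtain ⟨k, hk⟩ := exists_mem_low g
  induction k with
  | zero =>
    have : lowSubgroup n 0 ≤ Subgroup.zpowers (z n) := by
      refine (Subgroup.closure_le _).2 ?_
      rintro g (rfl | ⟨i, h1, h2, h3, rfl⟩)
      · exact Subgroup.mem_zpowers _
      · omega
    obtain ⟨m, rfl⟩ := this hk
    rcases Int.even_or_odd' m with ⟨r, rfl | rfl⟩
    · left; simp [zpow_mul, zpow_ofNat, pow_two, z_sq]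
    · right; simp [zpow_add, zpow_mul, zpow_ofNat, pow_two, z_sq]
  | succ k ih =>
    by_cases hkn : (k : ℕ∞) < n
    · obtain ⟨h, hh, d, hd, rfl⟩ := exists_cosetRep hkn hk
      have h1 : theta n (h * cosetRep n k d) (k + 1 - d) = k + 1 := by
        rw [map_mul, Equiv.Perm.mul_apply, theta_cosetRep hkn d hd, theta_low hh (by omega)]
      rw [hg, Equiv.Perm.one_apply] at h1
      obtain rfl : d = 0 := by omega
      apply ih
      simpa [cosetRep] using hh
    · exact ih (low_succ_le hkn hk)

theorem eq_or_eq_z_mul {n : ℕ∞} {g h : Cover n} (e : theta n g = theta n h) : g = h ∨ g = z n * h := by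
  have : theta n (g * h⁻¹) = 1 := by rw [map_mul, map_inv, e, mul_inv_cancel]
  rcases eq_one_or_z_of_theta this with h | h
  · left; exact mul_inv_eq_one.1 h
  · right; exact mul_inv_eq_iff_eq_mul.1 h

theorem emb_injective {n m : ℕ∞} (h : n ≤ m) : Function.Injective (emb h) := by
  rw [injective_iff_map_eq_one]
  intro g hg
  have : theta n g = 1 := by rw [← theta_emb h, hg, map_one]
  rcases eq_one_or_z_of_theta this with rfl | rfl
  · rfl
  · rw [emb_z] at hg; exact absurd hg (z_ne_one m)

/-! ## Permutations of `Fin n` -/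

/-- The inclusion of `Fin n` as `{1, …, n}`. -/
def shift (n : ℕ) : Fin n ↪ ℕ := ⟨fun i => i + 1, fun i j h => Fin.ext (by simpa using h)⟩

@[simp] theorem shift_apply {n : ℕ} (i : Fin n) : shift n i = i + 1 := rfl

theorem mem_range_shift {n j : ℕ} : j ∈ Set.range (shift n) ↔ 1 ≤ j ∧ j ≤ n := by
  constructor
  · rintro ⟨i, rfl⟩; simp
  · rintro ⟨h1, h2⟩; exact ⟨⟨j - 1, by omega⟩, by simp; omega⟩

theorem viaEmbedding_swap {α β : Type*} [DecidableEq α] [DecidableEq β] (f : α ↪ β) (a b : α) :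
    (Equiv.swap a b).viaEmbedding f = Equiv.swap (f a) (f b) := by
  ext x
  by_cases hx : x ∈ Set.range f
  · obtain ⟨y, rfl⟩ := hx
    rw [Equiv.Perm.viaEmbedding_apply, f.injective.swap_apply]
  · rw [Equiv.Perm.viaEmbedding_apply_of_notMem _ _ _ hx, Equiv.swap_apply_of_ne_of_ne]
    · rintro rfl; exact hx ⟨a, rfl⟩
    · rintro rfl; exact hx ⟨b, rfl⟩

/-- The images of the generators in the permutations of `Fin n`. -/
def genPermFin (n : ℕ) : Gen n → Equiv.Perm (Fin n)
  | .z => 1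
  | .t i h => Equiv.swap ⟨i - 1, by have := h.1; have : i < n := by exact_mod_cast h.2
                                    omega⟩ ⟨i, by exact_mod_cast h.2⟩

theorem via_genPermFin (n : ℕ) (r : FreeGroup (Gen n)) :
    Equiv.Perm.viaEmbeddingHom (shift n) (FreeGroup.lift (genPermFin n) r) =
      FreeGroup.lift (genPerm n) r := by
  rw [← MonoidHom.comp_apply]
  congr 1
  ext g : 1
  cases g with
  | z => simp [genPermFin, genPerm]
  | t i h =>
    have := h.1
    simp only [MonoidHom.comp_apply, FreeGroup.lift_apply_of, genPermFin, genPerm,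
      Equiv.Perm.viaEmbeddingHom_apply, viaEmbedding_swap, shift_apply]
    rw [Nat.sub_add_cancel this]

/-- The projection of the `n`-th cover to the permutations of `Fin n`. -/
def perm (n : ℕ) : Cover n →* Equiv.Perm (Fin n) :=
  PresentedGroup.toGroup (f := genPermFin n) (rels := {r | Rel n r}) (by
    intro r hr
    apply Equiv.Perm.viaEmbeddingHom_injective (shift n)
    rw [via_genPermFin, map_one, genPerm_rel n r hr])

@[simp] theorem perm_z (n : ℕ) : perm n (z n) = 1 := PresentedGroup.toGroup.of _

theorem perm_t {n i : ℕ} (h1 : 1 ≤ i) (h2 : i < n) :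
    perm n (t n i) = Equiv.swap ⟨i - 1, by omega⟩ ⟨i, h2⟩ := by
  rw [t_eq_of ⟨h1, by exact_mod_cast h2⟩]; exact PresentedGroup.toGroup.of _

theorem theta_eq_via {n : ℕ} (g : Cover n) : theta n g = (perm n g).viaEmbedding (shift n) := by
  have : theta n = (Equiv.Perm.viaEmbeddingHom (shift n)).comp (perm n) := by
    refine hom_eq_of_gens (by simp) fun i hi => ?_
    have h2 : i < n := by exact_mod_cast hi.2
    rw [theta_t hi, MonoidHom.comp_apply, perm_t hi.1 h2, Equiv.Perm.viaEmbeddingHom_apply,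
      viaEmbedding_swap, shift_apply, shift_apply]
    simp [Nat.sub_add_cancel hi.1]
  rw [this]; rfl

theorem theta_apply {n : ℕ} (g : Cover n) (i : Fin n) : theta n g (i + 1) = perm n g i + 1 := by
  rw [theta_eq_via]; exact Equiv.Perm.viaEmbedding_apply _ (shift n) i

theorem theta_apply_of_not {n : ℕ} (g : Cover n) {j : ℕ} (h : ¬ (1 ≤ j ∧ j ≤ n)) :
    theta n g j = j := by
  rw [theta_eq_via]
  exact Equiv.Perm.viaEmbedding_apply_of_notMem _ _ _ (by rwa [mem_range_shift])

theorem perm_eq_iff {n : ℕ} {g h : Cover n} : perm n g = perm n h ↔ g = h ∨ g = z n * h := by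
  constructor
  · intro e
    exact eq_or_eq_z_mul (by rw [theta_eq_via, theta_eq_via, e])
  · rintro (rfl | rfl) <;> simp

theorem perm_surjective (n : ℕ) : Function.Surjective (perm n) := by
  cases n with
  | zero => exact fun σ => ⟨1, Subsingleton.elim _ _⟩
  | succ n =>
    have h : MonoidHom.mrange (perm (n + 1)) = ⊤ := by
      rw [eq_top_iff, ← Equiv.Perm.mclosure_swap_castSucc_succ n]
      refine Submonoid.closure_le.2 ?_
      rintro _ ⟨i, rfl⟩
      refine ⟨t _ (i + 1), ?_⟩
      rw [perm_t (by omega) (by omega)]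
      rfl
    exact MonoidHom.mrange_eq_top.1 h

theorem perm_emb {n m : ℕ} (h : (n : ℕ∞) ≤ m) (g : Cover n) :
    perm m (emb h g) = (perm n g).viaEmbedding (Fin.castLEEmb (by exact_mod_cast h)) := by
  have h' : n ≤ m := by exact_mod_cast h
  have : (perm m).comp (emb h) = (Equiv.Perm.viaEmbeddingHom (Fin.castLEEmb h')).comp (perm n) := by
    refine hom_eq_of_gens (by simp) fun i hi => ?_
    have h2 : i < n := by exact_mod_cast hi.2
    rw [MonoidHom.comp_apply, emb_t h hi, perm_t hi.1 (by omega), MonoidHom.comp_apply,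
      perm_t hi.1 h2, Equiv.Perm.viaEmbeddingHom_apply, viaEmbedding_swap]
    rfl
  exact DFunLike.congr_fun this g

theorem cycleType_viaEmbedding {α β : Type*} [Fintype α] [DecidableEq α] [Fintype β] [DecidableEq β]
    (σ : Equiv.Perm α) (f : α ↪ β) : (σ.viaEmbedding f).cycleType = σ.cycleType := by
  unfold Equiv.Perm.viaEmbedding
  convert @Equiv.Perm.cycleType_extendDomain α _ _ β _ _ _ (Classical.decPred _)
    (Equiv.ofInjective f.1 f.2) σ

theorem cycleType_perm_emb {n m : ℕ} (h : (n : ℕ∞) ≤ m) (g : Cover n) :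
    (perm m (emb h g)).cycleType = (perm n g).cycleType := by
  rw [perm_emb, cycleType_viaEmbedding]

theorem exists_theta_eq {n : ℕ} {σ : Equiv.Perm ℕ} (hσ : ∀ j, ¬ (1 ≤ j ∧ j ≤ n) → σ j = j) :
    ∃ s : Cover n, theta n s = σ := by
  classical
  have hmem : ∀ j, j ∈ Set.range (shift n) ↔ σ j ∈ Set.range (shift n) := by
    intro j
    rw [mem_range_shift, mem_range_shift]
    constructor
    · intro hj
      by_contra hc
      have h1 := hσ _ hc
      rw [σ.injective h1] at hc
      exact hc hj
    · intro hj
      by_contra hc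
      rw [hσ j hc] at hj
      exact hc hj
  obtain ⟨s, hs⟩ := perm_surjective n (((Equiv.ofInjective (shift n) (shift n).injective).symm).permCongr
    (σ.subtypePerm (p := (· ∈ Set.range (shift n))) (fun j => (hmem j).symm)))
  refine ⟨s, ?_⟩
  ext j
  by_cases hj : j ∈ Set.range (shift n)
  · rw [theta_eq_via, hs]
    obtain ⟨i, rfl⟩ := hj
    rw [Equiv.Perm.viaEmbedding_apply]
    simp only [Equiv.permCongr_apply, Equiv.symm_symm]
    rw [Equiv.apply_ofInjective_symm (shift n).injective]
    simp
  · rw [mem_range_shift] at hj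
    rw [theta_apply_of_not _ hj, hσ j hj]

/-- An element of a cover comes from the `n`-th one if its permutation fixes everything outside
`{1, …, n}`. -/
theorem mem_range_emb {n : ℕ} {m : ℕ∞} (h : (n : ℕ∞) ≤ m) {g : Cover m}
    (hg : ∀ j, ¬ (1 ≤ j ∧ j ≤ n) → theta m g j = j) : ∃ s, emb h s = g := by
  obtain ⟨s, hs⟩ := exists_theta_eq hg
  rcases eq_or_eq_z_mul ((theta_emb h s).trans hs) with h1 | h1
  · exact ⟨s, h1⟩
  · exact ⟨z n * s, by rw [map_mul, emb_z, h1, z_mul_z_mul]⟩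

theorem theta_zero {n : ℕ∞} (g : Cover n) : theta n g 0 = 0 := by
  refine mem_of_gens ((MulAction.stabilizer (Equiv.Perm ℕ) 0).comap (theta n)) (by simp)
    (fun i hi => ?_) g
  rw [Subgroup.mem_comap, theta_t hi, MulAction.mem_stabilizer_iff, Equiv.Perm.smul_def]
  exact Equiv.swap_apply_of_ne_of_ne (by omega) (by omega)

theorem exists_emb_eq (g : Cover ⊤) : ∃ (n : ℕ) (s : Cover n), emb le_top s = g := by
  obtain ⟨k, hk⟩ := exists_mem_low g
  refine ⟨k, mem_range_emb le_top fun j hj => ?_⟩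
  rcases Nat.eq_zero_or_pos j with rfl | h
  · exact theta_zero g
  · exact theta_low hk (by omega)

instance finite_cover (n : ℕ) : Finite (Cover n) := by
  classical
  let f : Equiv.Perm (Fin n) × Bool → Cover n := fun p =>
    if p.2 then z n * (perm_surjective n p.1).choose else (perm_surjective n p.1).choose
  refine Finite.of_surjective f fun g => ?_
  have h := (perm_surjective n (perm n g)).choose_spec
  rcases perm_eq_iff.1 h.symm with h1 | h1
  · exact ⟨(perm n g, false), h1.symm⟩
  · exact ⟨(perm n g, true), h1.symm⟩

/-! ## Lifts of disjoint permutations -/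

theorem parity_mul_eq_one {n : ℕ∞} (a b : Cover n) :
    parity n (a * b) = 1 ↔ (parity n a = 1 ↔ parity n b = 1) := by
  rw [map_mul]
  generalize parity n a = x
  generalize parity n b = y
  revert x y
  decide

theorem parity_inv {n : ℕ∞} (a : Cover n) : parity n a⁻¹ = parity n a := by
  rw [map_inv]
  generalize parity n a = x
  revert x
  decide

theorem parity_conj {n : ℕ∞} (g a : Cover n) : parity n (g * a * g⁻¹) = parity n a := by
  simp

theorem parity_eq_one_iff {n : ℕ} (g : Cover n) :
    parity n g = 1 ↔ Equiv.Perm.sign (perm n g) = 1 := by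
  let χ : Multiplicative (ZMod 2) →* ℤˣ :=
    { toFun := fun x => if x = 1 then 1 else -1
      map_one' := by simp
      map_mul' := by decide }
  have h : χ.comp (parity n) = Equiv.Perm.sign.comp (perm n) := by
    refine hom_eq_of_gens (by simp) fun i hi => ?_
    have h2 : i < n := by exact_mod_cast hi.2
    rw [MonoidHom.comp_apply, MonoidHom.comp_apply, parity_t hi, perm_t hi.1 h2,
      Equiv.Perm.sign_swap]
    · rfl
    · have := hi.1
      rw [Ne, Fin.mk.injEq]; omega
  have h' : χ (parity n g) = Equiv.Perm.sign (perm n g) := DFunLike.congr_fun h g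
  rw [← h']
  generalize parity n g = x
  revert x
  decide

/-- `a b = ± b a` in the spin algebra, with the sign of the superalgebra commutation rule. -/
def SuperComm {n : ℕ∞} (a b : Cover n) : Prop :=
  a * b = (if parity n a = 1 ∨ parity n b = 1 then 1 else z n) * (b * a)

theorem SuperComm.symm {n : ℕ∞} {a b : Cover n} (h : SuperComm a b) : SuperComm b a := by
  unfold SuperComm at *
  rw [h]
  by_cases h1 : parity n a = 1 <;> by_cases h2 : parity n b = 1 <;> simp [h1, h2, z_mul_z_mul]

theorem SuperComm.mul_left {n : ℕ∞} {a a' b : Cover n} (h : SuperComm a b) (h' : SuperComm a' b) :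
    SuperComm (a * a') b := by
  have hc : ∀ (p : Prop) [Decidable p] (g : Cover n), g * (if p then 1 else z n) =
      (if p then 1 else z n) * g := by
    intro p _ g
    split_ifs <;> simp [z_comm]
  unfold SuperComm at *
  rw [mul_assoc, h', ← mul_assoc, hc, mul_assoc, ← mul_assoc a, h, mul_assoc _ (b * a), mul_assoc b,
    ← mul_assoc]
  congr 1
  have := parity_mul_eq_one a a'
  by_cases h1 : parity n a = 1 <;> by_cases h2 : parity n b = 1 <;>
    by_cases h3 : parity n a' = 1 <;> simp only [h1, h3, iff_true, iff_false, not_true] at this <;>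
    simp [h1, h2, h3, this, z_sq, -map_mul]

theorem SuperComm.z_left {n : ℕ∞} (b : Cover n) : SuperComm (z n) b := by
  simp [SuperComm, z_comm]

theorem SuperComm.conj {n : ℕ∞} {a b : Cover n} (h : SuperComm a b) (g : Cover n) :
    SuperComm (g * a * g⁻¹) (g * b * g⁻¹) := by
  unfold SuperComm at *
  rw [parity_conj, parity_conj]
  have : g * a * g⁻¹ * (g * b * g⁻¹) = g * (a * b) * g⁻¹ := by group
  rw [this, h]
  split_ifs <;> simp [mul_assoc, mul_z_mul]

/-- Two lifts of a permutation differ by `z`, which is even and central, so super-commutation is a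
property of the underlying permutations. -/
theorem SuperComm.of_perm {n : ℕ} {a b a' b' : Cover n} (h : SuperComm a b)
    (ha : perm n a' = perm n a) (hb : perm n b' = perm n b) : SuperComm a' b' := by
  have : SuperComm a' b := by
    rcases perm_eq_iff.1 ha with rfl | rfl
    · exact h
    · exact (SuperComm.z_left _).mul_left h
  rcases perm_eq_iff.1 hb with rfl | rfl
  · exact this
  · exact ((SuperComm.z_left _).mul_left this.symm).symm

theorem exists_perm_apply {α : Type*} {k : ℕ} (f g : Fin k ↪ α) :
    ∃ σ : Equiv.Perm α, ∀ i, σ (f i) = g i := by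
  have := Equiv.Perm.isMultiplyPretransitive α k
  obtain ⟨σ, hσ⟩ := MulAction.exists_smul_eq (Equiv.Perm α) f g
  exact ⟨σ, fun i => by rw [← hσ]; rfl⟩

theorem conj_swap {α : Type*} [DecidableEq α] (σ : Equiv.Perm α) (i j : α) :
    σ * Equiv.swap i j * σ⁻¹ = Equiv.swap (σ i) (σ j) := by
  rw [Equiv.swap_apply_apply]

/-- Any two disjoint transpositions are simultaneously conjugate to those of `t 1` and `t 3`, where
the claim is a defining relation. -/
theorem superComm_swap {n : ℕ} {a b : Cover n} {i j k l : Fin n} (h : [i, j, k, l].Nodup)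
    (ha : perm n a = Equiv.swap i j) (hb : perm n b = Equiv.swap k l) : SuperComm a b := by
  have hn : 4 ≤ n := by
    have := h.length_le_card
    simpa using this
  obtain ⟨σ, hσ⟩ := exists_perm_apply (Fin.castLEEmb hn)
    ⟨[i, j, k, l].get, List.nodup_iff_injective_get.1 h⟩
  obtain ⟨g, rfl⟩ := perm_surjective n σ
  have e1 : SuperComm (t n 1) (t n 3) := by
    have h1 : (1 : ℕ) ≤ 1 ∧ ((1 : ℕ) : ℕ∞) < n := ⟨le_rfl, by exact_mod_cast (by omega : 1 < n)⟩
    have h3 : (1 : ℕ) ≤ 3 ∧ ((3 : ℕ) : ℕ∞) < n := ⟨by omega, by exact_mod_cast (by omega : 3 < n)⟩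
    have hne : (Multiplicative.ofAdd (1 : ZMod 2)) ≠ 1 := by decide
    rw [SuperComm, parity_t h1, parity_t h3, t_far (i := 3) (j := 1) h3 h1 (by omega)]
    simp [hne, mul_assoc]
  refine (e1.conj g).of_perm ?_ ?_
  · rw [map_mul, map_mul, perm_t (by omega) (by omega), map_inv, conj_swap, ha]
    exact congrArg₂ _ (hσ 0).symm (hσ 1).symm
  · rw [map_mul, map_mul, perm_t (by omega) (by omega), map_inv, conj_swap, hb]
    exact congrArg₂ _ (hσ 2).symm (hσ 3).symm

/-- Induction on the support of `a`: splitting off the transposition of `i` and its image shrinks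
the support and keeps both factors disjoint from `b`. Using this once in each argument reduces the
general case to two transpositions. -/
theorem superComm_of_swaps {n : ℕ} {b : Cover n}
    (h : ∀ (a : Cover n) (i j : Fin n), i ≠ j → perm n a = Equiv.swap i j →
      (perm n a).Disjoint (perm n b) → SuperComm a b) (m : ℕ) :
    ∀ a : Cover n, (perm n a).support.card ≤ m → (perm n a).Disjoint (perm n b) → SuperComm a b := by
  induction m with
  | zero =>
    intro a ha _
    have h1 : perm n a = 1 := by simpa using ha
    refine SuperComm.of_perm (a := z n) (SuperComm.z_left b) (by simp [h1]) rfl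
  | succ m ih =>
    intro a ha hd
    by_cases h1 : perm n a = 1
    · exact SuperComm.of_perm (a := z n) (SuperComm.z_left b) (by simp [h1]) rfl
    · obtain ⟨i, hi⟩ : ∃ i, perm n a i ≠ i := by
        by_contra hc; push Not at hc; exact h1 (Equiv.ext hc)
      obtain ⟨s, hs⟩ := perm_surjective n (Equiv.swap i (perm n a i))
      have hfix : ∀ j, perm n b j ≠ j → perm n a j = j := fun j hj => (hd j).resolve_right hj
      have hsd : (perm n s).Disjoint (perm n b) := by
        intro j
        by_cases hj : perm n b j = j
        · exact Or.inr hj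
        · left
          have := hfix j hj
          rw [hs]
          apply Equiv.swap_apply_of_ne_of_ne
          · rintro rfl; exact hi this
          · intro hc; rw [hc] at this; exact hi ((perm n a).injective this)
      have h2 : SuperComm s b := h s i _ (Ne.symm hi) hs hsd
      have h3 : SuperComm (s * a) b := by
        refine ih _ ?_ ?_
        · rw [map_mul, hs]
          have := Equiv.Perm.card_support_swap_mul hi
          omega
        · rw [map_mul]
          exact hsd.mul_left hd
      refine (h2.mul_left h3).of_perm ?_ rfl
      simp [hs]

/-- Lifts of disjoint permutations commute up to the sign given by the parities. -/
theorem superComm_of_disjoint {n : ℕ} {a b : Cover n} (h : (perm n a).Disjoint (perm n b)) :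
    SuperComm a b := by
  refine superComm_of_swaps (fun a i j hij ha hd => ?_) _ a le_rfl h
  refine (superComm_of_swaps (fun b k l hkl hb hd' => ?_) _ b le_rfl hd.symm).symm
  refine (superComm_swap ?_ ha hb).symm
  rw [ha, hb] at hd'
  have := hd'
  have h1 : Equiv.swap i j i ≠ i := by simp [hij.symm]
  have h2 : Equiv.swap i j j ≠ j := by simp [hij]
  have h3 := (this i).resolve_right h1
  have h4 := (this j).resolve_right h2
  have : i ≠ k ∧ i ≠ l ∧ j ≠ k ∧ j ≠ l := by
    refine ⟨?_, ?_, ?_, ?_⟩ <;> rintro rfl <;> simp [hkl, hkl.symm] at h3 h4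
  simp [hij, hkl, this]

/-! ## Split classes -/

/-- An even element whose permutation has a cycle of even length is conjugate to its product
with `z`. -/
theorem isConj_z_mul {n : ℕ} {g : Cover n} (hg : parity n g = 1) {m : ℕ}
    (hm : m ∈ (perm n g).cycleType) (hev : Even m) : IsConj g (z n * g) := by
  rw [Equiv.Perm.cycleType_def, Multiset.mem_map] at hm
  obtain ⟨c, hc, rfl⟩ := hm
  rw [Finset.mem_val] at hc
  obtain ⟨a, rfl⟩ := perm_surjective n c
  have hcyc := (Equiv.Perm.mem_cycleFactorsFinset_iff.1 hc).1
  have hodd : parity n a ≠ 1 := by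
    rw [Ne, parity_eq_one_iff, hcyc.sign, Function.comp_apply] at *
    rw [Even.neg_one_pow hev]; decide
  have hd : (perm n (g * a⁻¹)).Disjoint (perm n a) := by
    rw [map_mul, map_inv]
    exact Equiv.Perm.disjoint_mul_inv_of_mem_cycleFactorsFinset hc
  have hodd' : parity n (g * a⁻¹) ≠ 1 := by
    rw [Ne, parity_mul_eq_one, parity_inv]; simp [hg, hodd]
  have := superComm_of_disjoint hd
  -- The lift `a` of the even-length cycle and the complementary factor `g a⁻¹` are both odd and
  -- disjoint, so `g = z a (g a⁻¹)`: conjugation by `a` multiplies `g` by `z`.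
  rw [SuperComm, if_neg (by tauto), inv_mul_cancel_right] at this
  rw [isConj_iff]
  refine ⟨a, ?_⟩
  rw [mul_assoc]
  nth_rewrite 2 [this]
  rw [z_mul_z_mul]

/-- All cycles have odd length. -/
def OddType {n : ℕ} (g : Cover n) : Prop := ∀ m ∈ (perm n g).cycleType, Odd m

theorem odd_lcm {s : Multiset ℕ} (h : ∀ m ∈ s, Odd m) : Odd s.lcm := by
  induction s using Multiset.induction with
  | empty => simp
  | cons a s ih =>
    rw [Multiset.lcm_cons]
    have h1 : Odd (a * s.lcm) := (h a (by simp)).mul (ih fun m hm => h m (by simp [hm]))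
    exact Odd.of_dvd_nat h1 (lcm_dvd_mul a s.lcm)

theorem odd_orderOf_iff {n : ℕ} {g : Cover n} (h : OddType g) :
    Odd (orderOf g) ↔ g ^ orderOf (perm n g) = 1 := by
  have ho : Odd (orderOf (perm n g)) := by
    rw [← Equiv.Perm.lcm_cycleType]; exact odd_lcm h
  constructor
  · intro hg
    have h1 : perm n (g ^ orderOf (perm n g)) = perm n 1 := by
      rw [map_pow, pow_orderOf_eq_one, map_one]
    rcases perm_eq_iff.1 h1 with h1 | h1
    · exact h1
    · exfalso
      rw [mul_one] at h1
      have h2 : z n ^ orderOf g = 1 := by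
        rw [← h1, ← pow_mul, mul_comm, pow_mul, pow_orderOf_eq_one, one_pow]
      obtain ⟨k, hk⟩ := hg
      rw [hk, pow_succ, pow_mul, pow_two, z_sq, one_pow, one_mul] at h2
      exact z_ne_one _ h2
  · intro hg
    exact ho.of_dvd_nat (orderOf_dvd_of_pow_eq_one hg)

/-- If `m` is the odd order of the permutation, `g ^ m` is `1` or `z`, and `(z g) ^ m = z g ^ m`
swaps the two cases. Thus the parity of the order tells the two lifts apart. -/
theorem odd_orderOf_z_mul {n : ℕ} {g : Cover n} (h : OddType g) :
    Odd (orderOf (z n * g)) ↔ ¬ Odd (orderOf g) := by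
  have h' : OddType (z n * g) := by simpa [OddType] using h
  have ho : Odd (orderOf (perm n g)) := by
    rw [← Equiv.Perm.lcm_cycleType]; exact odd_lcm h
  have e : perm n (z n * g) = perm n g := by simp
  rw [odd_orderOf_iff h, odd_orderOf_iff h', e]
  have h1 : perm n (g ^ orderOf (perm n g)) = perm n 1 := by
    rw [map_pow, pow_orderOf_eq_one, map_one]
  have hz : z n ^ orderOf (perm n g) = z n := by
    obtain ⟨k, hk⟩ := ho
    rw [hk, pow_succ, pow_mul, pow_two, z_sq, one_pow, one_mul]
  have hc : Commute (z n) g := z_comm g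
  rw [hc.mul_pow, hz]
  rcases perm_eq_iff.1 h1 with h1 | h1
  · rw [h1]; simp [z_ne_one]
  · rw [h1, mul_one]; simp [z_ne_one, z_sq]

/-- Conjugate permutations make `g` conjugate to `h` or to `z h`; the parity of the order rules out
the latter. -/
theorem isConj_of_cycleType {n : ℕ} {g h : Cover n} (hg : OddType g)
    (e : (perm n g).cycleType = (perm n h).cycleType)
    (ho : Odd (orderOf g) ↔ Odd (orderOf h)) : IsConj g h := by
  obtain ⟨σ, hσ⟩ := isConj_iff.1 (Equiv.Perm.isConj_of_cycleType_eq e)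
  obtain ⟨s, rfl⟩ := perm_surjective n σ
  have h1 : perm n (s * g * s⁻¹) = perm n h := by simp [hσ]
  have hc : IsConj g (s * g * s⁻¹) := isConj_iff.2 ⟨s, rfl⟩
  rcases perm_eq_iff.1 h1 with h1 | h1
  · rwa [h1] at hc
  · have h2 : orderOf g = orderOf (z n * h) := by
      rw [← h1]
      exact (orderOf_injective (MulAut.conj s).toMonoidHom (MulAut.conj s).injective g).symm
    have hh : OddType h := by rw [OddType, ← e]; exact hg
    rw [h2, odd_orderOf_z_mul hh] at ho
    tauto

theorem orderOf_eq_of_isConj {G : Type*} [Group G] {g h : G} (e : IsConj g h) :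
    orderOf g = orderOf h := by
  obtain ⟨s, rfl⟩ := isConj_iff.1 e
  exact (orderOf_injective (MulAut.conj s).toMonoidHom (MulAut.conj s).injective g).symm

/-! ## Cycle types of the distinguished elements -/

theorem formPerm_map {α β : Type*} [DecidableEq α] (σ : Equiv.Perm α) (l : List α) :
    (l.map σ).formPerm = σ * l.formPerm * σ⁻¹ := by
  match l with
  | [] => simp
  | [a] => simp
  | a :: b :: l =>
    have ih := formPerm_map (β := β) σ (b :: l)
    rw [List.map_cons] at ih
    rw [List.map_cons, List.map_cons, List.formPerm_cons_cons, List.formPerm_cons_cons, ih,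
      ← conj_swap]
    group

theorem prod_swap_reverse {α : Type*} [DecidableEq α] (a : α) (l : List α) (h : (a :: l).Nodup) :
    (l.reverse.map (fun c => Equiv.swap c a)).prod = (a :: l).formPerm := by
  induction l with
  | nil => simp
  | cons j l ih =>
    have h1 : j ≠ a ∧ a ∉ l ∧ j ∉ l ∧ l.Nodup := by
      simp only [List.nodup_cons, List.mem_cons, not_or] at h
      exact ⟨fun e => h.1.1 e.symm, h.1.2, h.2.1, h.2.2⟩
    have e : (a :: l).map (Equiv.swap a j) = j :: l := by
      rw [List.map_cons, Equiv.swap_apply_left]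
      congr 1
      refine (List.map_congr_left fun c hc => ?_).trans (List.map_id l)
      apply Equiv.swap_apply_of_ne_of_ne <;> rintro rfl
      · exact h1.2.1 hc
      · exact h1.2.2.1 hc
    rw [List.reverse_cons, List.map_append, List.prod_append, ih (List.nodup_cons.2 ⟨h1.2.1, h1.2.2.2⟩),
      List.formPerm_cons_cons, ← e, formPerm_map (β := α)]
    simp [← mul_assoc, Equiv.swap_comm j a]

/-- Conjugation by the transposition of `a` and `b` recentres the star transpositions from `b` to
`a`. With `b` the extra point `n + 1`, this is the shape of the definition of `cycle`. -/
theorem star_formula {α : Type*} [DecidableEq α] (a b : α) (l : List α) (h : (b :: a :: l).Nodup) :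
    Equiv.swap a b * (l.reverse.map (fun c => Equiv.swap c b)).prod * Equiv.swap a b =
      (a :: l).formPerm := by
  rw [← prod_swap_reverse a l (List.nodup_cons.1 h).2]
  have h1 : ∀ c ∈ l, c ≠ a ∧ c ≠ b := by
    intro c hc
    simp only [List.nodup_cons, List.mem_cons, not_or] at h
    exact ⟨by rintro rfl; exact h.2.1 hc, by rintro rfl; exact h.1.2 hc⟩
  have h2 := map_list_prod (MulAut.conj (Equiv.swap a b)) (l.reverse.map (fun c => Equiv.swap c b))
  rw [MulAut.conj_apply, Equiv.swap_inv] at h2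
  rw [h2, List.map_map]
  congr 1
  refine List.map_congr_left fun c hc => ?_
  have := h1 c (List.mem_reverse.1 hc)
  rw [Function.comp_apply, MulAut.conj_apply, conj_swap, Equiv.swap_apply_of_ne_of_ne this.1 this.2,
    Equiv.swap_apply_right]

theorem x_self (n : ℕ) : x n n = t (n + 1 : ℕ) n := by simp [x]

theorem x_of_lt {n i : ℕ} (h : i < n) :
    x n i = t (n + 1 : ℕ) i * x n (i + 1) * t (n + 1 : ℕ) i := by
  have : n - i = (n - (i + 1)) + 1 := by omega
  rw [x, x, this, List.range'_succ]
  simp [mul_assoc]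

/-- The element `j` of `{1, …, n + 1}` as an element of `Fin (n + 1)`. -/
def point (n j : ℕ) : Fin (n + 1) := Fin.ofNat (n + 1) (j - 1)

theorem point_val {n j : ℕ} (h : j ≤ n + 1) : (point n j : ℕ) = j - 1 := by
  simp only [point, Fin.ofNat]
  exact Nat.mod_eq_of_lt (by omega)

theorem point_inj {n i j : ℕ} (hi : 1 ≤ i) (hi' : i ≤ n + 1) (hj : 1 ≤ j) (hj' : j ≤ n + 1)
    (h : point n i = point n j) : i = j := by
  have := congrArg Fin.val h
  rw [point_val hi', point_val hj'] at this
  omega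

theorem exists_point {n : ℕ} (i : Fin (n + 1)) : ∃ j, 1 ≤ j ∧ j ≤ n + 1 ∧ i = point n j :=
  ⟨i + 1, by omega, by omega, Fin.ext (by rw [point_val (by omega)]; rfl)⟩

theorem perm_t_point {n i : ℕ} (h1 : 1 ≤ i) (h2 : i ≤ n) :
    perm (n + 1) (t (n + 1 : ℕ) i) = Equiv.swap (point n i) (point n (i + 1)) := by
  rw [perm_t h1 (by omega)]
  congr 1 <;> ext <;> rw [point_val (by omega)]
  rfl

theorem perm_x {n i : ℕ} (h1 : 1 ≤ i) (h2 : i ≤ n) :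
    perm (n + 1) (x n i) = Equiv.swap (point n i) (point n (n + 1)) := by
  induction h2 using Nat.decreasingInduction with
  | self => rw [x_self, perm_t_point h1 le_rfl]
  | of_succ i hi ih =>
    rw [x_of_lt (by omega), map_mul, map_mul, ih (by omega), perm_t_point h1 (by omega)]
    have := conj_swap (Equiv.swap (point n i) (point n (i + 1))) (point n (i + 1)) (point n (n + 1))
    rw [Equiv.swap_inv, Equiv.swap_apply_right, Equiv.swap_apply_of_ne_of_ne] at this
    · exact this
    · intro e; have := point_inj (by omega) (by omega) (by omega) (by omega) e; omega
    · intro e; have := point_inj (by omega) (by omega) (by omega) (by omega) e; omega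

theorem nodup_map_point {n : ℕ} {l : List ℕ} (hl : l.Nodup) (h : ∀ i ∈ l, 1 ≤ i ∧ i ≤ n + 1) :
    (l.map (point n)).Nodup :=
  hl.map_on fun i hi j hj e => point_inj (h i hi).1 (h i hi).2 (h j hj).1 (h j hj).2 e

theorem perm_cycle {n : ℕ} {l : List ℕ} (hl : l.Nodup) (h : ∀ i ∈ l, 1 ≤ i ∧ i ≤ n) :
    perm (n + 1) (cycle n l) = (l.map (point n)).formPerm := by
  match l with
  | [] => simp [cycle]
  | [a] => simp [cycle]
  | i :: j :: l =>
    rw [cycle, map_mul, map_mul, perm_x (h i (by simp)).1 (h i (by simp)).2, map_list_prod,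
      List.map_map, List.map_cons, ← star_formula (point n i) (point n (n + 1)) ((j :: l).map (point n)),
      ← List.map_reverse, List.map_map]
    · congr 3
      refine List.map_congr_left fun c hc => ?_
      have := h c (by rw [List.mem_reverse] at hc; exact List.mem_cons_of_mem _ hc)
      simp [perm_x this.1 this.2]
    · have := nodup_map_point (n := n) (l := (n + 1) :: i :: j :: l) ?_ ?_
      · exact this
      · refine List.nodup_cons.2 ⟨fun hc => ?_, hl⟩
        have := h _ hc; omega
      · intro c hc
        rcases List.mem_cons.1 hc with rfl | hc
        · omega
        · have := h c hc; omega

/-- The fixed points below `s` make the first cycle disjoint from the rest in the induction; the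
fixed point `n + 1` later shows that `tElem` comes from the `n`-th cover. -/
theorem cycleType_cyclesFrom {n : ℕ} (l : List ℕ) (hpos : ∀ p ∈ l, 0 < p) (s : ℕ) (hs : 1 ≤ s)
    (hsum : s + l.sum + l.length ≤ n + 1) :
    (perm (n + 1) (cyclesFrom n s l)).cycleType = (l.map (· + 1) : List ℕ) ∧
      ∀ j, 1 ≤ j → j ≤ n + 1 → (j < s ∨ j = n + 1) →
        perm (n + 1) (cyclesFrom n s l) (point n j) = point n j := by
  induction l generalizing s with
  | nil => simp [cyclesFrom]
  | cons p l ih =>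
    rw [List.sum_cons, List.length_cons] at hsum
    obtain ⟨ih1, ih2⟩ := ih (fun q hq => hpos q (by simp [hq])) (s + p + 1) (by omega) (by omega)
    have hp := hpos p (by simp)
    have hmem : ∀ i ∈ List.range' s (p + 1), 1 ≤ i ∧ i ≤ n := by
      intro i hi; rw [List.mem_range'_1] at hi; omega
    have hnd : (List.range' s (p + 1)).Nodup := List.nodup_range'
    have hnd' := nodup_map_point hnd (n := n) (fun i hi => ⟨(hmem i hi).1, (hmem i hi).2.trans n.le_succ⟩)
    have hfix : ∀ j, 1 ≤ j → j ≤ n + 1 → (j < s ∨ s + p < j) →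
        ((List.range' s (p + 1)).map (point n)).formPerm (point n j) = point n j := by
      intro j h1 h2 h3
      apply List.formPerm_apply_of_notMem
      intro hc
      obtain ⟨i, hi, e⟩ := List.mem_map.1 hc
      have h4 := hmem i hi
      have := point_inj h4.1 (by omega) h1 h2 e
      rw [List.mem_range'_1] at hi
      omega
    rw [cyclesFrom, map_mul, perm_cycle hnd hmem]
    constructor
    · have hd : (((List.range' s (p + 1)).map (point n)).formPerm).Disjoint
          (perm (n + 1) (cyclesFrom n (s + p + 1) l)) := by
        intro i
        obtain ⟨j, h1, h2, rfl⟩ := exists_point i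
        by_cases h : j < s + p + 1
        · right; exact ih2 j h1 h2 (Or.inl h)
        · left; exact hfix j h1 h2 (by omega)
      rw [hd.cycleType_mul, ih1, (List.isCycle_formPerm hnd' (by simp; omega)).cycleType,
        List.support_formPerm_of_nodup _ hnd', List.toFinset_card_of_nodup hnd']
      · simp
      · intro y hy
        have := congrArg List.length hy
        simp at this
        omega
    · intro j h1 h2 h3
      rw [Equiv.Perm.mul_apply, ih2 j h1 h2 (by omega)]
      exact hfix j h1 h2 (by omega)

namespace EvenPartition

/-- The cycle type `(λ₁ + 1, λ₂ + 1, …)`. -/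
def typ (la : EvenPartition) : Multiset ℕ := (la.parts.map (· + 1) : List ℕ)

theorem typ_sum (la : EvenPartition) : la.typ.sum = la.size + la.length := by
  rw [typ, Multiset.sum_coe, List.sum_map_add]
  simp [size, length]

theorem typ_card (la : EvenPartition) : Multiset.card la.typ = la.length := by
  simp [typ, length]

theorem odd_of_mem_typ {la : EvenPartition} {m : ℕ} (h : m ∈ la.typ) : Odd m := by
  rw [typ, Multiset.mem_coe, List.mem_map] at h
  obtain ⟨p, hp, rfl⟩ := h
  exact (la.even p hp).add_one

theorem typ_injective : Function.Injective typ := by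
  intro la mu h
  have h1 : (la.parts.map (· + 1)).Perm (mu.parts.map (· + 1)) := Multiset.coe_eq_coe.1 h
  have h2 := h1.map (· - 1)
  simp only [List.map_map, Function.comp_def, Nat.add_sub_cancel, List.map_id'] at h2
  have h3 := h2.eq_of_pairwise (fun a b _ _ hab hba => le_antisymm hba hab) la.sorted mu.sorted
  cases la; cases mu; simpa using h3

theorem exists_typ {s : Multiset ℕ} (h : ∀ m ∈ s, Odd m ∧ 2 ≤ m) : ∃ la : EvenPartition, la.typ = s := by
  have hm : ∀ i ∈ (s.map (· - 1)).sort (· ≥ ·), ∃ m ∈ s, m - 1 = i := by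
    intro i hi
    rw [Multiset.mem_sort, Multiset.mem_map] at hi
    exact hi
  refine ⟨⟨(s.map (· - 1)).sort (· ≥ ·), Multiset.pairwise_sort _ _, ?_, ?_⟩, ?_⟩
  · intro i hi
    obtain ⟨m, hm, rfl⟩ := hm i hi
    have := (h m hm).2; omega
  · intro i hi
    obtain ⟨m, hm, rfl⟩ := hm i hi
    exact (h m hm).1.tsub_odd odd_one
  · rw [typ, ← Multiset.map_coe, Multiset.sort_eq, Multiset.map_map]
    refine (Multiset.map_congr rfl fun m hm => ?_).trans (Multiset.map_id s)
    have := (h m hm).2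
    simp; omega

/-- `|la| + ℓ(la)`, the number of points moved by an element of modified type `la`. -/
def degree (la : EvenPartition) : ℕ := la.size + la.length

end EvenPartition

theorem cycleType_tElem {n : ℕ} {la : EvenPartition} (h : la.size + la.length ≤ n) :
    (perm (n + 1) (tElem n la)).cycleType = la.typ :=
  (cycleType_cyclesFrom la.parts la.pos 1 le_rfl
    (by simp only [EvenPartition.size, EvenPartition.length] at h; omega)).1

theorem exists_emb_eq_tElem {n : ℕ} {la : EvenPartition} (h : la.size + la.length ≤ n) :
    ∃ s : Cover n, emb (by exact_mod_cast n.le_succ) s = tElem n la := by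
  refine mem_range_emb _ fun j hj => ?_
  by_cases hj' : j = n + 1
  · have h1 := (cycleType_cyclesFrom la.parts la.pos 1 le_rfl
      (by simp only [EvenPartition.size, EvenPartition.length] at h; omega)).2 (n + 1)
      (by omega) le_rfl (Or.inr rfl)
    have h2 := theta_apply (tElem n la) (point n (n + 1))
    rw [tElem, h1, point_val le_rfl] at h2
    rw [hj']
    exact h2
  · exact theta_apply_of_not _ (by omega)

/-! ## Stability of the classes -/

theorem nat_gen_lt {i n : ℕ} (h1 : 1 ≤ i) (h2 : i < n) : 1 ≤ i ∧ (i : ℕ∞) < (n : ℕ∞) :=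
  ⟨h1, by exact_mod_cast h2⟩

/-- The embedding of the `(n + 1)`-st cover in the `(n + 2)`-nd followed by conjugation with
`tₙ₊₁`. -/
noncomputable def twist (n : ℕ) : Cover (n + 1 : ℕ) →* Cover (n + 1 + 1 : ℕ) :=
  (MulAut.conj (t (n + 1 + 1 : ℕ) (n + 1))).toMonoidHom.comp
    (emb (by exact_mod_cast (n + 1).le_succ))

theorem twist_apply (n : ℕ) (g : Cover (n + 1 : ℕ)) : twist n g =
    t (n + 1 + 1 : ℕ) (n + 1) * emb (by exact_mod_cast (n + 1).le_succ) g *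
      (t (n + 1 + 1 : ℕ) (n + 1))⁻¹ := rfl

theorem twist_z (n : ℕ) : twist n (z _) = z _ := by
  rw [twist_apply, emb_z, ← z_comm, mul_assoc, mul_inv_cancel, mul_one]

theorem twist_t {n i : ℕ} (h1 : 1 ≤ i) (h2 : i < n) :
    twist n (t _ i) = z _ * t _ i := by
  rw [twist_apply, emb_t _ (nat_gen_lt h1 (by omega)), t_far (nat_gen_lt h1 (by omega))
    (nat_gen_lt (by omega) (by omega)) (by omega)]
  simp [mul_assoc]

/-- The braid relation gives the case `i = n`, the `z` coming from `t⁻¹ = z t`. Each further step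
adds two letters `t i`, whose signs under `twist` cancel. -/
theorem x_succ_eq {n i : ℕ} (h1 : 1 ≤ i) (h2 : i ≤ n) : x (n + 1) i = z _ * twist n (x n i) := by
  induction h2 using Nat.decreasingInduction with
  | self =>
    rw [x_of_lt (by omega), x_self, x_self, t_braid h1 (by exact_mod_cast (by omega : n + 1 < n + 1 + 1)),
      twist_apply, emb_t _ (nat_gen_lt h1 (by omega)), t_inv (nat_gen_lt (by omega) (by omega)),
      mul_z_mul, z_mul_z_mul]
  | of_succ i hi ih =>
    rw [x_of_lt (by omega), ih (by omega), x_of_lt hi, map_mul, map_mul, twist_t h1 hi]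
    simp only [mul_assoc, mul_z_mul, z_mul_z_mul]

theorem map_x_prod {n : ℕ} (l : List ℕ) (h : ∀ i ∈ l, 1 ≤ i ∧ i ≤ n) :
    (l.map (x (n + 1))).prod = z _ ^ l.length * twist n (l.map (x n)).prod := by
  induction l with
  | nil => simp
  | cons a l ih =>
    rw [List.map_cons, List.prod_cons, ih (fun i hi => h i (by simp [hi])),
      x_succ_eq (h a (by simp)).1 (h a (by simp)).2, List.map_cons, List.prod_cons, map_mul,
      List.length_cons, pow_succ]
    have : ∀ k g, z (n + 1 + 1 : ℕ) ^ k * g = g * z _ ^ k := fun k g => Commute.pow_left (show Commute _ _ from z_comm g) k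
    simp only [← mul_assoc]
    congr 1
    rw [mul_assoc, ← this, mul_assoc, mul_z_mul]

/-- A cycle of odd length `m > 1` is a product of `m + 1` elements `x`, so the factors `z` of
`x_succ_eq` cancel in pairs. -/
theorem cycle_succ {n : ℕ} {l : List ℕ} (h : ∀ i ∈ l, 1 ≤ i ∧ i ≤ n) (hl : Odd l.length) :
    cycle (n + 1) l = twist n (cycle n l) := by
  match l with
  | [] => simp at hl
  | [a] => rw [cycle, cycle, twist_z]
  | i :: j :: l =>
    have he : Even (j :: l).reverse.length := by
      rw [List.length_cons] at hl
      rw [List.length_reverse]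
      exact Nat.odd_add_one.1 hl |> Nat.not_odd_iff_even.1
    have hz : z (n + 1 + 1 : ℕ) ^ (j :: l).reverse.length = 1 := by
      obtain ⟨k, hk⟩ := he
      rw [hk, ← two_mul, pow_mul, pow_two, z_sq, one_pow]
    rw [cycle, cycle, x_succ_eq (h i (by simp)).1 (h i (by simp)).2,
      map_x_prod _ (fun c hc => h c (by rw [List.mem_reverse] at hc; exact List.mem_cons_of_mem _ hc)),
      hz, one_mul, map_mul, map_mul]
    simp only [mul_assoc, mul_z_mul, z_mul_z_mul]

theorem cyclesFrom_succ {n : ℕ} (l : List ℕ) (hev : ∀ p ∈ l, Even p) (s : ℕ) (hs : 1 ≤ s)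
    (hsum : s + l.sum + l.length ≤ n + 1) : cyclesFrom (n + 1) s l = twist n (cyclesFrom n s l) := by
  induction l generalizing s with
  | nil => simp [cyclesFrom]
  | cons p l ih =>
    rw [List.sum_cons, List.length_cons] at hsum
    rw [cyclesFrom, cyclesFrom, map_mul, ih (fun q hq => hev q (by simp [hq])) _ (by omega) (by omega),
      cycle_succ]
    · intro i hi; rw [List.mem_range'_1] at hi; omega
    · rw [List.length_range']; exact (hev p (by simp)).add_one

/-- Whether the distinguished element of modified type `la` has odd order. -/
def OddOrd (la : EvenPartition) : Prop := Odd (orderOf (tElem la.degree la))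

/-- Passing from `n` to `n + 1` applies the injective homomorphism `twist`, which preserves orders.
-/
theorem odd_orderOf_tElem {n : ℕ} {la : EvenPartition} (h : la.size + la.length ≤ n) :
    Odd (orderOf (tElem n la)) ↔ OddOrd la := by
  induction n, h using Nat.le_induction with
  | base => rfl
  | succ n hn ih =>
    rw [← ih, tElem, cyclesFrom_succ la.parts la.even 1 le_rfl
      (by simp only [EvenPartition.size, EvenPartition.length] at hn; omega), orderOf_injective]
    · rfl
    · exact (MulAut.conj _).injective.comp (emb_injective _)

/-- This description no longer refers to `tElem n la`, and both conditions are preserved by the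
embeddings. Which parity `OddOrd la` prescribes never has to be computed. -/
theorem mem_D_iff {n : ℕ} {la : EvenPartition} {g : Cover n} :
    g ∈ D n la ↔ (perm n g).cycleType = la.typ ∧ (Odd (orderOf g) ↔ OddOrd la) := by
  constructor
  · rintro ⟨h, s, hs, hc⟩
    have h1 : (perm n s).cycleType = la.typ := by
      rw [← cycleType_tElem h, ← hs]; exact (cycleType_perm_emb _ s).symm
    constructor
    · obtain ⟨c, rfl⟩ := isConj_iff.1 hc
      rw [map_mul, map_mul, map_inv, Equiv.Perm.cycleType_conj, h1]
    · rw [← orderOf_eq_of_isConj hc, ← odd_orderOf_tElem h, ← hs, orderOf_injective _ (emb_injective _)]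
  · rintro ⟨h1, h2⟩
    have h : la.size + la.length ≤ n := by
      rw [← la.typ_sum, ← h1]
      simpa using (perm n g).sum_cycleType_le
    obtain ⟨s, hs⟩ := exists_emb_eq_tElem h
    have h3 : (perm n s).cycleType = la.typ := by
      rw [← cycleType_tElem h, ← hs]; exact (cycleType_perm_emb _ s).symm
    refine ⟨h, s, hs, isConj_of_cycleType ?_ (h3.trans h1.symm) ?_⟩
    · intro m hm; rw [h3] at hm; exact EvenPartition.odd_of_mem_typ hm
    · rw [h2, ← odd_orderOf_tElem h, ← hs, orderOf_injective _ (emb_injective _)]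

theorem emb_mem_D {n m : ℕ} (h : (n : ℕ∞) ≤ m) {la : EvenPartition} {g : Cover n} :
    emb h g ∈ D m la ↔ g ∈ D n la := by
  rw [mem_D_iff, mem_D_iff, cycleType_perm_emb, orderOf_injective _ (emb_injective _)]

theorem emb_mem_DInf {n : ℕ} {la : EvenPartition} {g : Cover n} :
    emb (le_top : (n : ℕ∞) ≤ ⊤) g ∈ DInf la ↔ g ∈ D n la := by
  constructor
  · intro h
    obtain ⟨m, k, hk, e⟩ := Set.mem_iUnion.1 h
    have hn : (n : ℕ∞) ≤ (max n m : ℕ) := by exact_mod_cast le_max_left n m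
    have hm : (m : ℕ∞) ≤ (max n m : ℕ) := by exact_mod_cast le_max_right n m
    rw [← emb_mem_D hn]
    have : emb hn g = emb hm k := by
      apply emb_injective (le_top : ((max n m : ℕ) : ℕ∞) ≤ ⊤)
      rw [emb_emb, emb_emb, e]
    rw [this, emb_mem_D]
    exact hk
  · exact fun h => Set.mem_iUnion.2 ⟨n, g, h, rfl⟩

/-! ## Coefficients in the spin group algebra -/

section algebra

variable (R : Type*) [CommRing R] (n : ℕ)

/-- Functions on the cover which change sign under `z`. -/
def antiFun : Submodule R (Cover n → R) where
  carrier := {f | ∀ h, f (z n * h) = - f h}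
  add_mem' := fun {f g} hf hg h => by simp [hf h, hg h, add_comm]
  zero_mem' := by simp
  smul_mem' := fun c f hf h => by simp [hf h]

/-- The left regular representation on the functions which change sign under `z`. -/
def leftRegular : Cover n →* Module.End R (antiFun R n) where
  toFun g :=
    { toFun := fun f => ⟨fun h => f.1 (g⁻¹ * h), fun h => by
        change f.1 (g⁻¹ * (z n * h)) = - f.1 (g⁻¹ * h)
        rw [mul_z_mul]; exact f.2 _⟩
      map_add' := fun _ _ => rfl
      map_smul' := fun _ _ => rfl }
  map_one' := by ext f h; simp
  map_mul' g k := by ext f h; simp [mul_assoc]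

theorem leftRegular_apply (g h : Cover n) (f : antiFun R n) :
    (leftRegular R n g f).1 h = f.1 (g⁻¹ * h) := rfl

/-- The left regular representation of the spin group algebra. -/
noncomputable def spinRegular : SpinAlg R n →ₐ[R] Module.End R (antiFun R n) :=
  RingQuot.liftAlgHom R ⟨MonoidAlgebra.lift R (Module.End R (antiFun R n)) (Cover n) (leftRegular R n), by
    rintro _ _ ⟨⟩
    rw [map_neg, map_one, MonoidAlgebra.lift_of]
    ext f h
    rw [leftRegular_apply, z_inv]
    exact f.2 h⟩

open Classical in
/-- The function `δ₁ - δ_z`. -/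
noncomputable def antiDelta : antiFun R n :=
  ⟨fun h => (if h = 1 then 1 else 0) - (if z n * h = 1 then 1 else 0), fun h => by
    simp only [z_mul_z_mul]; ring⟩

/-- The image of a group element in the spin group algebra. -/
noncomputable def spinOf (g : Cover n) : SpinAlg R n := proj R n (MonoidAlgebra.of R _ g)

/-- The coefficients of an element of the spin group algebra: `coeff x g` is the coefficient of
`g` for any choice of representatives modulo `z` which contains `g`. -/
noncomputable def coeff : SpinAlg R n →ₗ[R] (Cover n → R) :=
  (antiFun R n).subtype ∘ₗ LinearMap.applyₗ (antiDelta R n) ∘ₗ (spinRegular R n).toLinearMap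

variable {R n}

theorem spinOf_mul (g h : Cover n) : spinOf R n (g * h) = spinOf R n g * spinOf R n h := by
  rw [spinOf, map_mul, map_mul]; rfl

theorem spinOf_z : spinOf R n (z n) = -1 := by
  rw [spinOf, proj, RingQuot.mkAlgHom_rel R (AlgRel.z_eq (R := R) (n := n)), map_neg, map_one]

theorem spinOf_z_mul (g : Cover n) : spinOf R n (z n * g) = - spinOf R n g := by
  rw [spinOf_mul, spinOf_z]; exact neg_one_mul (spinOf R n g)

theorem spinRegular_spinOf (g : Cover n) : spinRegular R n (spinOf R n g) = leftRegular R n g := by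
  rw [spinRegular, spinOf, proj, RingQuot.liftAlgHom_mkAlgHom_apply, MonoidAlgebra.lift_of]

theorem coeff_spinOf_mul (g h : Cover n) (y : SpinAlg R n) :
    coeff R n (spinOf R n g * y) h = coeff R n y (g⁻¹ * h) := by
  simp only [coeff, LinearMap.comp_apply, AlgHom.toLinearMap_apply, map_mul, spinRegular_spinOf]
  rfl

open Classical in
theorem coeff_spinOf (g h : Cover n) :
    coeff R n (spinOf R n g) h = (if h = g then 1 else 0) - (if z n * h = g then 1 else 0) := by
  have := coeff_spinOf_mul (R := R) g h 1
  rw [mul_one] at this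
  rw [this]
  have h2 : coeff R n 1 (g⁻¹ * h) = (antiDelta R n).1 (g⁻¹ * h) := by
    simp only [coeff, LinearMap.comp_apply, AlgHom.toLinearMap_apply, map_one]
    rfl
  rw [h2, antiDelta]
  have h3 : ∀ k, g⁻¹ * k = 1 ↔ k = g := fun k => by rw [inv_mul_eq_one, eq_comm]
  simp only [← mul_z_mul g⁻¹, h3]

theorem coeff_z_mul (y : SpinAlg R n) (h : Cover n) : coeff R n y (z n * h) = - coeff R n y h :=
  (spinRegular R n y (antiDelta R n)).2 h

theorem span_spinOf : Submodule.span R (Set.range (spinOf R n)) = ⊤ := by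
  rw [eq_top_iff]
  rintro y -
  obtain ⟨f, rfl⟩ := RingQuot.mkAlgHom_surjective R (AlgRel R n) y
  induction f using MonoidAlgebra.induction_on with
  | of g => exact Submodule.subset_span ⟨g, rfl⟩
  | add f g hf hg => rw [map_add]; exact add_mem hf hg
  | smul r f hf => rw [map_smul]; exact Submodule.smul_mem _ r hf

/-- `coeff` is built from left multiplication, so right translation is checked on the spanning group
elements. -/
theorem coeff_mul_spinOf (g h : Cover n) (y : SpinAlg R n) :
    coeff R n (y * spinOf R n g) h = coeff R n y (h * g⁻¹) := by
  have hy : y ∈ Submodule.span R (Set.range (spinOf R n)) := by rw [span_spinOf]; trivial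
  induction hy using Submodule.span_induction with
  | mem y hy =>
    obtain ⟨k, rfl⟩ := hy
    classical
    rw [← spinOf_mul, coeff_spinOf, coeff_spinOf]
    simp only [← mul_assoc, mul_inv_eq_iff_eq_mul]
  | zero => simp
  | add a b _ _ ha hb => rw [add_mul, map_add, map_add, Pi.add_apply, Pi.add_apply, ha, hb]
  | smul r a _ ha => rw [smul_mul_assoc, map_smul, map_smul, Pi.smul_apply, Pi.smul_apply, ha]

-- A left inverse is obtained by choosing one element from each pair `g`, `z g` and summing the
-- coefficients against the chosen elements.
open Classical in
theorem coeff_injective : Function.Injective (coeff R n) := by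
  have := Fintype.ofFinite (Cover n)
  let sec : Cover n → Prop := fun g => g = (perm_surjective n (perm n g)).choose
  have hsec : ∀ g, sec (z n * g) ↔ ¬ sec g := by
    intro g
    have h1 := (perm_surjective n (perm n g)).choose_spec
    have h2 : perm n (z n * g) = perm n g := by simp
    simp only [sec]
    rw [h2]
    rcases perm_eq_iff.1 h1 with h | h
    · rw [h]; simp [z_ne_one]
    · rw [h]; simp [(z_mul_ne g).symm]
  let Ψ : (Cover n → R) →ₗ[R] SpinAlg R n :=
    ∑ g : Cover n, (if sec g then (1 : R) else 0) • (LinearMap.proj g).smulRight (spinOf R n g)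
  have key : Ψ ∘ₗ coeff R n = LinearMap.id := by
    refine LinearMap.ext_on_range span_spinOf fun h => ?_
    simp only [Ψ, LinearMap.comp_apply, LinearMap.sum_apply, LinearMap.smul_apply,
      LinearMap.smulRight_apply, LinearMap.proj_apply, coeff_spinOf, LinearMap.id_apply, sub_smul,
      smul_sub]
    rw [Finset.sum_sub_distrib]
    have e : ∀ g, z n * g = h ↔ g = z n * h := fun g =>
      ⟨fun e => by rw [← e, z_mul_z_mul], fun e => by rw [e, z_mul_z_mul]⟩
    simp only [e, smul_ite, smul_zero, Finset.sum_ite_eq', Finset.mem_univ, if_true, ite_smul,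
      one_smul, zero_smul, hsec, spinOf_z_mul]
    by_cases h1 : sec h <;> simp [h1]
  intro a b hab
  have := congrArg Ψ hab
  rwa [← LinearMap.comp_apply, ← LinearMap.comp_apply, key] at this

end algebra

/-! ## Class sums -/

theorem oddType_of_mem_D {n : ℕ} {la : EvenPartition} {g : Cover n} (h : g ∈ D n la) : OddType g := by
  intro m hm
  rw [(mem_D_iff.1 h).1] at hm
  exact EvenPartition.odd_of_mem_typ hm

theorem eq_of_mem_D {n : ℕ} {la mu : EvenPartition} {g : Cover n} (h : g ∈ D n la) (h' : g ∈ D n mu) :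
    la = mu :=
  EvenPartition.typ_injective ((mem_D_iff.1 h).1.symm.trans (mem_D_iff.1 h').1)

theorem z_mul_notMem_D {n : ℕ} {la mu : EvenPartition} {g : Cover n} (h : g ∈ D n la) :
    z n * g ∉ D n mu := by
  intro h'
  have h1 := mem_D_iff.1 h
  have h2 := mem_D_iff.1 h'
  have : la = mu := EvenPartition.typ_injective (by rw [← h1.1, ← h2.1]; simp)
  subst this
  have := odd_orderOf_z_mul (oddType_of_mem_D h)
  tauto

theorem mem_D_of_isConj {n : ℕ} {la : EvenPartition} {g h : Cover n} (e : IsConj g h) :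
    g ∈ D n la ↔ h ∈ D n la :=
  ⟨fun ⟨h1, s, hs, hc⟩ => ⟨h1, s, hs, hc.trans e⟩, fun ⟨h1, s, hs, hc⟩ => ⟨h1, s, hs, hc.trans e.symm⟩⟩

theorem isConj_of_mem_D {n : ℕ} {la : EvenPartition} {g h : Cover n} (hg : g ∈ D n la)
    (hh : h ∈ D n la) : IsConj g h :=
  isConj_of_cycleType (oddType_of_mem_D hg) ((mem_D_iff.1 hg).1.trans (mem_D_iff.1 hh).1.symm)
    ((mem_D_iff.1 hg).2.trans (mem_D_iff.1 hh).2.symm)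

theorem D_nonempty {n : ℕ} {la : EvenPartition} : (D n la).Nonempty ↔ la.size + la.length ≤ n := by
  constructor
  · rintro ⟨g, h, -⟩; exact h
  · intro h
    obtain ⟨s, hs⟩ := exists_emb_eq_tElem h
    exact ⟨s, h, s, hs, IsConj.refl s⟩

theorem EvenPartition.even_size (la : EvenPartition) : Even la.size := by
  obtain ⟨l, _, _, h⟩ := la
  simp only [EvenPartition.size]
  induction l with
  | nil => simp
  | cons a l ih =>
    rw [List.sum_cons]
    exact (h a (by simp)).add (ih (by simp_all) (by simp_all) (fun i hi => h i (by simp [hi])))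

theorem parity_of_mem_D {n : ℕ} {la : EvenPartition} {g : Cover n} (h : g ∈ D n la) :
    parity n g = 1 := by
  rw [parity_eq_one_iff, Equiv.Perm.sign_of_cycleType, (mem_D_iff.1 h).1, la.typ_sum, la.typ_card,
    add_assoc]
  exact (la.even_size.add (Even.add_self _)).neg_one_pow

/-- The even elements which are not in a split class of odd type are conjugate to their product
with `z`. -/
theorem class_cases {n : ℕ} (g : Cover n) : (∃ la, g ∈ D n la) ∨ (∃ la, z n * g ∈ D n la) ∨
    parity n g ≠ 1 ∨ IsConj g (z n * g) := by
  by_cases hp : parity n g = 1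
  swap
  · tauto
  by_cases ho : OddType g
  swap
  · obtain ⟨m, hm, hm'⟩ : ∃ m ∈ (perm n g).cycleType, ¬ Odd m := by
      unfold OddType at ho; push Not at ho; exact ho
    exact Or.inr (Or.inr (Or.inr (isConj_z_mul hp hm (Nat.not_odd_iff_even.1 hm'))))
  obtain ⟨la, hla⟩ := EvenPartition.exists_typ (s := (perm n g).cycleType)
    fun m hm => ⟨ho m hm, Equiv.Perm.two_le_of_mem_cycleType hm⟩
  have h2 := odd_orderOf_z_mul ho
  by_cases h : Odd (orderOf g) ↔ OddOrd la
  · exact Or.inl ⟨la, mem_D_iff.2 ⟨hla.symm, h⟩⟩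
  · refine Or.inr (Or.inl ⟨la, mem_D_iff.2 ⟨by simp [hla], by tauto⟩⟩)

section center

variable {R : Type*} [CommRing R] {n : ℕ}

open Classical in
theorem coeff_d (la : EvenPartition) (g : Cover n) :
    coeff R n (d R n la) g = (if g ∈ D n la then 1 else 0) - (if z n * g ∈ D n la then 1 else 0) := by
  rw [d, finsum_mem_eq_finite_toFinset_sum _ (Set.toFinite _), map_sum, map_sum, Finset.sum_apply]
  have : ∀ h, coeff R n (proj R n (MonoidAlgebra.of R (Cover n) h)) g =
    (if g = h then 1 else 0) - (if z n * g = h then 1 else 0) := fun h => coeff_spinOf h g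
  simp only [this]
  rw [Finset.sum_sub_distrib, Finset.sum_ite_eq, Finset.sum_ite_eq]
  simp only [Set.Finite.mem_toFinset]

theorem coeff_d_of_mem {la : EvenPartition} {g : Cover n} (h : g ∈ D n la) (mu : EvenPartition)
    [Decidable (la = mu)] : coeff R n (d R n mu) g = if la = mu then 1 else 0 := by
  classical
  rw [coeff_d, if_neg (z_mul_notMem_D h), sub_zero]
  by_cases e : la = mu
  · subst e; simp [h]
  · rw [if_neg e, if_neg fun h' => e (eq_of_mem_D h h')]

/-- Multiplication by a group element on the left or right translates coefficients, and the two
translated arguments are conjugate; group elements span. -/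
theorem commute_of_coeff {y : SpinAlg R n}
    (hy : ∀ g h, IsConj g h → coeff R n y g = coeff R n y h) (w : SpinAlg R n) : w * y = y * w := by
  have hw : w ∈ Submodule.span R (Set.range (spinOf R n)) := by rw [span_spinOf]; trivial
  induction hw using Submodule.span_induction with
  | mem w hw =>
    obtain ⟨s, rfl⟩ := hw
    apply coeff_injective
    ext h
    rw [coeff_spinOf_mul, coeff_mul_spinOf]
    exact hy _ _ (isConj_iff.2 ⟨s, by group⟩)
  | zero => simp
  | add a b _ _ ha hb => rw [add_mul, mul_add, ha, hb]
  | smul r a _ ha => rw [smul_mul_assoc, mul_smul_comm, ha]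

theorem d_eq_sum (la : EvenPartition) :
    d R n la = ∑ g ∈ (Set.toFinite (D n la)).toFinset, spinOf R n g := by
  rw [d, finsum_mem_eq_finite_toFinset_sum _ (Set.toFinite _), map_sum]; rfl

theorem d_mem_evenCenter (la : EvenPartition) : d R n la ∈ evenCenter R n := by
  classical
  refine ⟨?_, ?_⟩
  · rw [SetLike.mem_coe, Subalgebra.mem_toSubmodule, Subalgebra.mem_center_iff]
    refine commute_of_coeff fun g h e => ?_
    have e' : IsConj (z n * g) (z n * h) := by
      obtain ⟨s, rfl⟩ := isConj_iff.1 e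
      exact isConj_iff.2 ⟨s, by simp [mul_assoc, mul_z_mul]⟩
    simp only [coeff_d, mem_D_of_isConj e, mem_D_of_isConj e']
  · rw [SetLike.mem_coe, d_eq_sum]
    refine sum_mem fun g hg => Submodule.subset_span ⟨g, ?_, rfl⟩
    exact parity_of_mem_D ((Set.Finite.mem_toFinset _).1 hg)

theorem mul_mem_evenPart {v w : SpinAlg R n} (hv : v ∈ evenPart R n) (hw : w ∈ evenPart R n) :
    v * w ∈ evenPart R n := by
  have := Submodule.mul_mem_mul hv hw
  rw [evenPart, Submodule.span_mul_span] at this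
  refine Submodule.span_mono ?_ this
  rintro _ ⟨_, ⟨g, hg, rfl⟩, _, ⟨h, hh, rfl⟩, rfl⟩
  exact ⟨g * h, by rw [map_mul, hg, hh, mul_one], (spinOf_mul g h).symm⟩

theorem mul_mem_evenCenter {v w : SpinAlg R n} (hv : v ∈ evenCenter R n) (hw : w ∈ evenCenter R n) :
    v * w ∈ evenCenter R n :=
  ⟨mul_mem (S := Subalgebra R (SpinAlg R n)) hv.1 hw.1, mul_mem_evenPart hv.2 hw.2⟩

theorem coeff_eq_zero_of_odd {y : SpinAlg R n} (hy : y ∈ evenPart R n) {g : Cover n}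
    (hg : parity n g ≠ 1) : coeff R n y g = 0 := by
  classical
  induction hy using Submodule.span_induction with
  | mem y hy =>
    obtain ⟨h, hh, rfl⟩ := hy
    change coeff R n (spinOf R n h) g = 0
    rw [coeff_spinOf, if_neg, if_neg, sub_zero]
    · rintro rfl; rw [map_mul, parity_z, one_mul] at hh; exact hg hh
    · rintro rfl; exact hg hh
  | zero => simp
  | add a b _ _ ha hb => rw [map_add, Pi.add_apply, ha, hb, add_zero]
  | smul r a _ ha => rw [map_smul, Pi.smul_apply, ha, smul_zero]

theorem coeff_conj {y : SpinAlg R n} (hy : y ∈ evenCenter R n) {g h : Cover n} (e : IsConj g h) :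
    coeff R n y g = coeff R n y h := by
  obtain ⟨s, rfl⟩ := isConj_iff.1 e
  have h1 := Subalgebra.mem_center_iff.1 ((Subalgebra.mem_toSubmodule _).1 hy.1) (spinOf R n s)
  have h2 := congrFun (congrArg (coeff R n) h1) (s * g)
  rw [coeff_spinOf_mul, coeff_mul_spinOf, inv_mul_cancel_left] at h2
  exact h2

/-- Elements of the even center are determined by their coefficients on the classes `D_la(n)`. -/
theorem evenCenter_ext (hR : ∀ r : R, 2 * r = 0 → r = 0) {v w : SpinAlg R n}
    (hv : v ∈ evenCenter R n) (hw : w ∈ evenCenter R n)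
    (h : ∀ la, ∀ g ∈ D n la, coeff R n v g = coeff R n w g) : v = w := by
  rw [← sub_eq_zero]
  have hy := sub_mem hv hw
  apply coeff_injective
  rw [map_zero]
  ext g
  have h0 : ∀ la, ∀ g ∈ D n la, coeff R n (v - w) g = 0 := fun la g hg => by
    rw [map_sub, Pi.sub_apply, h la g hg, sub_self]
  rw [Pi.zero_apply]
  rcases class_cases g with ⟨la, h1⟩ | ⟨la, h1⟩ | h1 | h1
  · exact h0 la g h1
  · have := h0 la _ h1
    rwa [coeff_z_mul, neg_eq_zero] at this
  · exact coeff_eq_zero_of_odd hy.2 h1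
  -- The coefficient at `g` equals its own negative; this is where the absence of 2-torsion enters.
  · have := coeff_conj hy h1
    rw [coeff_z_mul] at this
    apply hR
    rw [two_mul]
    nth_rewrite 1 [this]
    exact neg_add_cancel _

instance finite_evenPartition_le (n : ℕ) : Finite {la : EvenPartition // la.size + la.length ≤ n} := by
  refine Finite.of_injective (β := Cover n) (fun la => (D_nonempty.2 la.2).some) fun la mu h => ?_
  have h1 := (D_nonempty.2 la.2).some_mem
  have h2 := (D_nonempty.2 mu.2).some_mem
  simp only at h
  rw [h] at h1
  exact Subtype.ext (eq_of_mem_D h1 h2)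

/-- Taking coefficients at one representative of each class gives functionals dual to the class
sums, and they determine an even central element by `evenCenter_ext`. -/
theorem classSumsFormBasis (hR : ∀ r : R, 2 * r = 0 → r = 0) : ClassSumsFormBasis R n := by
  classical
  have := Fintype.ofFinite {la : EvenPartition // la.size + la.length ≤ n}
  constructor
  · rw [Fintype.linearIndependent_iff]
    intro c hc la
    have h1 := (D_nonempty.2 la.2).some_mem
    have h2 := congrFun (congrArg (coeff R n) hc) (D_nonempty.2 la.2).some
    rw [map_sum, map_zero, Finset.sum_apply] at h2
    simpa [coeff_d_of_mem h1, ← Subtype.ext_iff] using h2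
  · apply le_antisymm
    · rw [Submodule.span_le]
      rintro _ ⟨la, rfl⟩
      exact d_mem_evenCenter la.1
    · intro y hy
      let c : {la : EvenPartition // la.size + la.length ≤ n} → R := fun la =>
        coeff R n y (D_nonempty.2 la.2).some
      have : y = ∑ la, c la • d R n la.1 := by
        refine evenCenter_ext hR hy (sum_mem fun la _ => Submodule.smul_mem _ _ (d_mem_evenCenter _)) ?_
        intro la g hg
        have hla := D_nonempty.1 ⟨g, hg⟩
        rw [map_sum, Finset.sum_apply, Finset.sum_eq_single ⟨la, hla⟩]
        · rw [map_smul, Pi.smul_apply, coeff_d_of_mem hg, if_pos rfl, smul_eq_mul, mul_one]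
          exact coeff_conj hy (isConj_of_mem_D hg (D_nonempty.2 hla).some_mem)
        · intro mu _ hmu
          rw [map_smul, Pi.smul_apply, coeff_d_of_mem hg, if_neg, smul_zero]
          rintro rfl
          exact hmu rfl
        · simp
      rw [this]
      exact sum_mem fun la _ => Submodule.smul_mem _ _ (Submodule.subset_span ⟨la, rfl⟩)

end center

/-! ## Structure constants -/

/-- The number of factorizations `e = a b` with `a ∈ D_la(n)` and `b ∈ D_mu(n)`. -/
noncomputable def count (n : ℕ) (la mu : EvenPartition) (e : Cover n) : ℕ :=
  {p : Cover n × Cover n | p.1 ∈ D n la ∧ p.2 ∈ D n mu ∧ p.1 * p.2 = e}.ncard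

theorem count_conj {n : ℕ} {la mu : EvenPartition} {e e' : Cover n} (h : IsConj e e') :
    count n la mu e = count n la mu e' := by
  obtain ⟨s, rfl⟩ := isConj_iff.1 h
  refine Set.ncard_congr (fun p _ => (s * p.1 * s⁻¹, s * p.2 * s⁻¹)) ?_ ?_ ?_
  · rintro ⟨a, b⟩ ⟨ha, hb, rfl⟩
    refine ⟨(mem_D_of_isConj (isConj_iff.2 ⟨s, rfl⟩)).1 ha,
      (mem_D_of_isConj (isConj_iff.2 ⟨s, rfl⟩)).1 hb, ?_⟩
    simp [mul_assoc]
  · rintro ⟨a, b⟩ ⟨a', b'⟩ _ _ h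
    simpa using h
  · rintro ⟨a, b⟩ ⟨ha, hb, h⟩
    refine ⟨(s⁻¹ * a * s, s⁻¹ * b * s), ⟨?_, ?_, ?_⟩, by simp [mul_assoc]⟩
    · exact (mem_D_of_isConj (isConj_iff.2 ⟨s⁻¹, by simp⟩)).1 ha
    · exact (mem_D_of_isConj (isConj_iff.2 ⟨s⁻¹, by simp⟩)).1 hb
    · simp only at h ⊢
      rw [show s⁻¹ * a * s * (s⁻¹ * b * s) = s⁻¹ * (a * b) * s by group, h]
      group

open Classical in
/-- The structure constants. -/
noncomputable def structureConst (la mu nu : EvenPartition) (n : ℕ) : ℤ :=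
  -- The value `0` for an empty class is arbitrary, since the class sum it multiplies is zero.
  if h : (D n nu).Nonempty then (count n la mu h.some : ℤ) - count n la mu (z n * h.some) else 0

theorem structureConst_eq {la mu nu : EvenPartition} {n : ℕ} {g : Cover n} (hg : g ∈ D n nu) :
    structureConst la mu nu n = (count n la mu g : ℤ) - count n la mu (z n * g) := by
  have h : (D n nu).Nonempty := ⟨g, hg⟩
  have e := isConj_of_mem_D h.some_mem hg
  rw [structureConst, dif_pos h, count_conj e, count_conj (e := z n * h.some) (e' := z n * g)]
  obtain ⟨s, hs⟩ := isConj_iff.1 e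
  exact isConj_iff.2 ⟨s, by rw [← hs]; simp [mul_assoc, mul_z_mul]⟩

theorem coeff_d_mul_d {R : Type*} [CommRing R] {n : ℕ} (la mu : EvenPartition) (g : Cover n) :
    coeff R n (d R n la * d R n mu) g = (count n la mu g : R) - count n la mu (z n * g) := by
  classical
  have hc : ∀ e : Cover n, (count n la mu e : R) =
      ∑ p ∈ (Set.toFinite (D n la)).toFinset ×ˢ (Set.toFinite (D n mu)).toFinset,
        if e = p.1 * p.2 then 1 else 0 := by
    intro e
    rw [Finset.sum_boole, count, ← Set.ncard_coe_finset]
    congr 2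
    ext p
    simp [and_assoc, @eq_comm _ e]
  rw [d_eq_sum, d_eq_sum, Finset.sum_mul_sum, ← Finset.sum_product', map_sum, Finset.sum_apply, hc, hc,
    ← Finset.sum_sub_distrib]
  refine Finset.sum_congr rfl fun p _ => ?_
  rw [← spinOf_mul, coeff_spinOf]

theorem isStructureConstants {R : Type*} [CommRing R] (hR : ∀ r : R, 2 * r = 0 → r = 0) :
    IsStructureConstants R structureConst := by
  classical
  intro la mu n
  have hfin : {nu : EvenPartition | nu.size + nu.length ≤ n}.Finite :=
    Set.finite_coe_iff.1 (finite_evenPartition_le n)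
  rw [finsum_eq_sum_of_support_subset (s := hfin.toFinset)]
  · refine evenCenter_ext hR (mul_mem_evenCenter (d_mem_evenCenter _) (d_mem_evenCenter _))
      (sum_mem fun la _ => Submodule.smul_mem _ _ (d_mem_evenCenter _)) ?_
    intro nu g hg
    rw [coeff_d_mul_d, map_sum, Finset.sum_apply, Finset.sum_eq_single nu]
    · rw [map_smul, Pi.smul_apply, coeff_d_of_mem hg, if_pos rfl, smul_eq_mul, mul_one,
        structureConst_eq hg]
      push_cast
      rfl
    · intro nu' _ hne
      rw [map_smul, Pi.smul_apply, coeff_d_of_mem hg, if_neg hne.symm, smul_zero]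
    · intro h
      exact absurd (D_nonempty.1 ⟨g, hg⟩) (by simpa using h)
  · intro nu hnu
    rw [Function.mem_support] at hnu
    by_contra hc
    apply hnu
    have : ¬ (D n nu).Nonempty := by rw [D_nonempty]; simpa using hc
    rw [Set.not_nonempty_iff_eq_empty] at this
    rw [d, this]
    simp

/-! ## The rank of a permutation -/

section rank

variable {α : Type*}

/-- The functions which are invariant under a permutation. -/
def invariants (σ : Equiv.Perm α) : Submodule ℚ (α → ℚ) where
  carrier := {f | ∀ i, f (σ i) = f i}
  add_mem' := fun {f g} hf hg i => by simp [hf i, hg i]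
  zero_mem' := by simp
  smul_mem' := fun c f hf i => by simp [hf i]

theorem invariants_sameCycle [Finite α] {σ : Equiv.Perm α} {f : α → ℚ} (hf : f ∈ invariants σ) {i j : α}
    (h : σ.SameCycle i j) : f i = f j := by
  have hn : ∀ (n : ℕ) i, f ((σ ^ n) i) = f i := by
    intro n
    induction n with
    | zero => simp
    | succ n ih => intro i; rw [pow_succ, Equiv.Perm.mul_apply, ih]; exact hf i
  obtain ⟨n, rfl⟩ := h.exists_nat_pow_eq
  exact (hn n i).symm

/-- Invariant functions are functions on the orbits. -/
def invariantsEquiv [Finite α] (σ : Equiv.Perm α) :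
    invariants σ ≃ₗ[ℚ] (Quotient (Equiv.Perm.SameCycle.setoid σ) → ℚ) where
  toFun f := Quotient.lift f.1 fun _ _ h => invariants_sameCycle f.2 h
  map_add' f g := by ext q; induction q using Quotient.inductionOn; rfl
  map_smul' c f := by ext q; induction q using Quotient.inductionOn; rfl
  invFun f := ⟨fun i => f ⟦i⟧, fun i => congrArg f (Quotient.sound
    (show σ.SameCycle (σ i) i from Equiv.Perm.sameCycle_apply_left.2 (Equiv.Perm.SameCycle.refl σ i)))⟩
  left_inv f := rfl
  right_inv f := by ext q; induction q using Quotient.inductionOn; rfl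

/-- Orbits correspond to nontrivial cycles together with fixed points, and `cycleType.sum` counts
the points that are not fixed. -/
theorem card_orbits [Fintype α] [DecidableEq α] (σ : Equiv.Perm α) :
    Nat.card (Quotient (Equiv.Perm.SameCycle.setoid σ)) + σ.cycleType.sum =
      Fintype.card α + Multiset.card σ.cycleType := by
  classical
  have hne : ∀ c ∈ σ.cycleFactorsFinset, c.support.Nonempty := fun c hc =>
    (Equiv.Perm.mem_cycleFactorsFinset_iff.1 hc).1.nonempty_support
  have hsup : ∀ c (hc : c ∈ σ.cycleFactorsFinset), (hne c hc).choose ∈ σ.support := fun c hc =>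
    Equiv.Perm.mem_cycleFactorsFinset_support_le hc (hne c hc).choose_spec
  have hcyc : ∀ c (hc : c ∈ σ.cycleFactorsFinset), c = σ.cycleOf (hne c hc).choose := fun c hc =>
    Equiv.Perm.cycle_is_cycleOf (hne c hc).choose_spec hc
  let φ : {c // c ∈ σ.cycleFactorsFinset} ⊕ (Function.fixedPoints σ) →
      Quotient (Equiv.Perm.SameCycle.setoid σ) :=
    Sum.elim (fun c => ⟦(hne c.1 c.2).choose⟧) (fun i => ⟦i.1⟧)
  have hmk : ∀ i j : α, (⟦i⟧ : Quotient (Equiv.Perm.SameCycle.setoid σ)) = ⟦j⟧ ↔ σ.SameCycle i j :=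
    fun i j => Quotient.eq
  have hφ : Function.Bijective φ := by
    constructor
    · rintro (⟨c, hc⟩ | ⟨i, hi⟩) (⟨c', hc'⟩ | ⟨j, hj⟩) h <;>
        simp only [φ, Sum.elim_inl, Sum.elim_inr, hmk] at h
      · congr 2
        rw [hcyc c hc, hcyc c' hc', h.cycleOf_eq]
      · exact absurd (h.apply_eq_self_iff.2 hj) (Equiv.Perm.mem_support.1 (hsup c hc))
      · exact absurd (h.apply_eq_self_iff.1 hi) (Equiv.Perm.mem_support.1 (hsup c' hc'))
      · congr 2
        exact h.eq_of_left hi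
    · intro q
      induction q using Quotient.inductionOn with
      | h i =>
        by_cases hi : σ i = i
        · exact ⟨Sum.inr ⟨i, hi⟩, rfl⟩
        · have hc := Equiv.Perm.cycleOf_mem_cycleFactorsFinset_iff.2 (Equiv.Perm.mem_support.2 hi)
          refine ⟨Sum.inl ⟨σ.cycleOf i, hc⟩, ?_⟩
          simp only [φ, Sum.elim_inl, hmk]
          exact ((Equiv.Perm.mem_support_cycleOf_iff.1 (hne _ hc).choose_spec).1).symm
  rw [← Nat.card_congr (Equiv.ofBijective φ hφ), Nat.card_sum, Nat.card_eq_fintype_card,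
    Nat.card_eq_fintype_card, Fintype.card_coe, Equiv.Perm.card_fixedPoints]
  have h1 : Multiset.card σ.cycleType = σ.cycleFactorsFinset.card := by
    rw [Equiv.Perm.cycleType_def, Multiset.card_map]; rfl
  have h2 := σ.sum_cycleType_le
  omega

theorem finrank_invariants [Fintype α] [DecidableEq α] (σ : Equiv.Perm α) :
    Module.finrank ℚ (invariants σ) + σ.cycleType.sum =
      Fintype.card α + Multiset.card σ.cycleType := by
  classical
  have := Fintype.ofFinite (Quotient (Equiv.Perm.SameCycle.setoid σ))
  rw [(invariantsEquiv σ).finrank_eq, Module.finrank_fintype_fun_eq_card, ← card_orbits,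
    Nat.card_eq_fintype_card]

theorem inf_invariants_le (σ τ : Equiv.Perm α) :
    invariants σ ⊓ invariants τ ≤ invariants (σ * τ) := by
  rintro f ⟨h1, h2⟩ i
  exact (h1 (τ i)).trans (h2 i)

/-- The rank of a permutation, the difference of the number of moved points and the number of
nontrivial cycles, is subadditive. -/
theorem rank_mul_le [Fintype α] [DecidableEq α] (σ τ : Equiv.Perm α) {a b c : ℕ}
    (ha : σ.cycleType.sum = a + Multiset.card σ.cycleType)
    (hb : τ.cycleType.sum = b + Multiset.card τ.cycleType)
    (hc : (σ * τ).cycleType.sum = c + Multiset.card (σ * τ).cycleType) :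
    c ≤ a + b ∧ (c = a + b → ∀ i, σ (τ i) = i → σ i = i ∧ τ i = i) := by
  have h1 := finrank_invariants σ
  have h2 := finrank_invariants τ
  have h3 := finrank_invariants (σ * τ)
  -- The rank is the codimension of the invariants. The intersection has codimension at most the sum
  -- of the two codimensions, and it lies in the invariants of the product.
  have h4 := Submodule.finrank_sup_add_finrank_inf_eq (invariants σ) (invariants τ)
  have h5 := Submodule.finrank_le (invariants σ ⊔ invariants τ)
  have h6 := Submodule.finrank_mono (inf_invariants_le σ τ)
  rw [Module.finrank_fintype_fun_eq_card] at h5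
  refine ⟨by omega, fun h i hi => ?_⟩
  -- Equality of ranks makes the two subspaces coincide; the indicator function of a point is
  -- invariant only if the point is fixed.
  have h7 := Submodule.eq_of_le_of_finrank_le (inf_invariants_le σ τ) (by omega)
  have h8 : Pi.single i (1 : ℚ) ∈ invariants (σ * τ) := by
    intro j
    by_cases hj : j = i
    · subst hj; rw [Equiv.Perm.mul_apply, hi]
    · rw [Pi.single_eq_of_ne hj, Pi.single_eq_of_ne]
      intro e
      exact hj ((σ * τ).injective (e.trans hi.symm))
  rw [← h7] at h8
  have key : ∀ ρ : Equiv.Perm α, Pi.single i (1 : ℚ) ∈ invariants ρ → ρ i = i := by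
    intro ρ h
    by_contra hne
    have := h i
    rw [Pi.single_eq_same, Pi.single_eq_of_ne hne] at this
    exact zero_ne_one this
  exact ⟨key σ h8.1, key τ h8.2⟩

end rank

/-! ## Counting factorizations by their sets of moved points -/

theorem DInf_conj {la : EvenPartition} {a : Cover ⊤} (g : Cover ⊤) (ha : a ∈ DInf la) :
    g * a * g⁻¹ ∈ DInf la := by
  obtain ⟨n, s, rfl⟩ := exists_emb_eq g
  obtain ⟨m, r, rfl⟩ := exists_emb_eq a
  have hn : (n : ℕ∞) ≤ (max n m : ℕ) := by exact_mod_cast le_max_left n m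
  have hm : (m : ℕ∞) ≤ (max n m : ℕ) := by exact_mod_cast le_max_right n m
  rw [← emb_emb hm le_top, emb_mem_DInf] at ha
  rw [← emb_emb hn le_top, ← emb_emb hm le_top, ← map_inv, ← map_mul, ← map_mul, emb_mem_DInf]
  exact (mem_D_of_isConj (isConj_iff.2 ⟨_, rfl⟩)).1 ha

/-- The factorizations `e = a b` with `a ∈ D_la` and `b ∈ D_mu` for which `U` is the set of points
moved by `a` or `b`. -/
def factorizations (la mu : EvenPartition) (e : Cover ⊤) (U : Finset ℕ) : Set (Cover ⊤ × Cover ⊤) :=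
  {p | p.1 ∈ DInf la ∧ p.2 ∈ DInf mu ∧ p.1 * p.2 = e ∧ moved p.1 p.2 = U}

theorem moved_emb {n : ℕ} (a b : Cover n) {j : ℕ} (hj : j ∈ moved (emb le_top a) (emb le_top b)) :
    1 ≤ j ∧ j ≤ n := by
  by_contra hc
  simp only [moved, theta_emb, Set.mem_ofPred_eq] at hj
  rw [theta_apply_of_not a hc, theta_apply_of_not b hc] at hj
  tauto

theorem exists_of_moved {n : ℕ} {a b : Cover ⊤} (h : moved a b ⊆ Finset.Icc 1 n) :
    ∃ a' b' : Cover n, emb le_top a' = a ∧ emb le_top b' = b := by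
  have key : ∀ j, ¬ (1 ≤ j ∧ j ≤ n) → theta ⊤ a j = j ∧ theta ⊤ b j = j := by
    intro j hj
    by_contra hc
    have : j ∈ moved a b := by simp only [moved, Set.mem_ofPred_eq]; tauto
    have := h this
    rw [Finset.coe_Icc, Set.mem_Icc] at this
    exact hj this
  obtain ⟨a', ha⟩ := mem_range_emb le_top fun j hj => (key j hj).1
  obtain ⟨b', hb⟩ := mem_range_emb le_top fun j hj => (key j hj).2
  exact ⟨a', b', ha, hb⟩

theorem finite_factorizations (la mu : EvenPartition) (e : Cover ⊤) (U : Finset ℕ) :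
    (factorizations la mu e U).Finite := by
  by_cases h0 : 0 ∈ U
  · refine Set.Finite.subset Set.finite_empty ?_
    rintro ⟨a, b⟩ ⟨-, -, -, h⟩
    have : 0 ∈ moved a b := by rw [h]; exact h0
    simp [moved, theta_zero] at this
  · have hU : U ⊆ Finset.Icc 1 (U.sup id) := by
      intro j hj
      rw [Finset.mem_Icc]
      refine ⟨Nat.pos_of_ne_zero ?_, Finset.le_sup (f := id) hj⟩
      rintro rfl; exact h0 hj
    refine Set.Finite.subset (Set.finite_range
      (fun p : Cover (U.sup id : ℕ) × Cover (U.sup id : ℕ) =>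
        (emb (le_top : _ ≤ (⊤ : ℕ∞)) p.1, emb (le_top : _ ≤ (⊤ : ℕ∞)) p.2))) ?_
    rintro ⟨a, b⟩ ⟨-, -, -, h⟩
    obtain ⟨a', b', ha, hb⟩ := exists_of_moved (a := a) (b := b) (by
      change moved a b = U at h
      rw [h]; exact_mod_cast hU)
    exact ⟨(a', b'), by simp [ha, hb]⟩

theorem count_eq_sum {n : ℕ} (la mu : EvenPartition) (e : Cover n) :
    count n la mu e =
      ∑ U ∈ (Finset.Icc 1 n).powerset, (factorizations la mu (emb le_top e) U).ncard := by
  classical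
  let s : Set (Cover n × Cover n) := {p | p.1 ∈ D n la ∧ p.2 ∈ D n mu ∧ p.1 * p.2 = e}
  let f : Cover n × Cover n → Finset ℕ := fun p =>
    (Finset.Icc 1 n).filter (· ∈ moved (emb le_top p.1) (emb le_top p.2))
  have hf : ∀ p : Cover n × Cover n, (f p : Set ℕ) = moved (emb le_top p.1) (emb le_top p.2) := by
    intro p
    ext j
    simp only [f, Finset.coe_filter, Finset.mem_Icc, Set.mem_ofPred_eq, and_iff_right_iff_imp]
    exact fun h => moved_emb _ _ h
  rw [count, Set.ncard_eq_toFinset_card s (Set.toFinite s),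
    Finset.card_eq_sum_card_fiberwise (f := f) (t := (Finset.Icc 1 n).powerset)]
  · refine Finset.sum_congr rfl fun U hU => ?_
    rw [← Set.ncard_coe_finset]
    refine Set.ncard_congr (fun p _ => (emb le_top p.1, emb le_top p.2)) ?_ ?_ ?_
    · rintro ⟨a, b⟩ h
      simp only [Finset.coe_filter, Set.Finite.mem_toFinset, Set.mem_ofPred_eq, s] at h
      obtain ⟨⟨ha, hb, rfl⟩, hU⟩ := h
      exact ⟨emb_mem_DInf.2 ha, emb_mem_DInf.2 hb, (map_mul _ _ _).symm, by rw [← hU, hf]⟩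
    · rintro ⟨a, b⟩ ⟨a', b'⟩ _ _ h
      simp only [Prod.mk.injEq] at h
      rw [emb_injective _ h.1, emb_injective _ h.2]
    · rintro ⟨a, b⟩ ⟨ha, hb, he, hm⟩
      simp only at ha hb he hm
      obtain ⟨a', b', rfl, rfl⟩ := exists_of_moved (n := n) (a := a) (b := b) (by
        rw [hm]; exact_mod_cast Finset.mem_powerset.1 hU)
      refine ⟨(a', b'), ?_, rfl⟩
      simp only [Finset.coe_filter, Set.Finite.mem_toFinset, Set.mem_ofPred_eq, s]
      refine ⟨⟨emb_mem_DInf.1 ha, emb_mem_DInf.1 hb, emb_injective _ (by rw [map_mul, he])⟩, ?_⟩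
      rw [← Finset.coe_inj, hf, hm]
  · intro p _
    rw [Finset.mem_coe, Finset.mem_powerset]
    exact Finset.filter_subset _ _

theorem moved_mul_subset {a b : Cover ⊤} {j : ℕ} (h : theta ⊤ (a * b) j ≠ j) : j ∈ moved a b := by
  by_contra hc
  simp only [moved, Set.mem_ofPred_eq, not_or, not_not] at hc
  rw [map_mul, Equiv.Perm.mul_apply, hc.2, hc.1] at h
  exact h rfl

/-- A permutation of the points greater than `N` which maps one set to another one. -/
theorem exists_perm_image {N : ℕ} {U U' : Finset ℕ} (hU : ∀ j ∈ U, 1 ≤ j) (hU' : ∀ j ∈ U', 1 ≤ j)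
    (h : Finset.Icc 1 N ⊆ U) (h' : Finset.Icc 1 N ⊆ U') (hc : U.card = U'.card) :
    ∃ (m : ℕ) (g : Cover m), (∀ j, j ≤ N → theta m g j = j) ∧ ∀ j, theta m g j ∈ U' ↔ j ∈ U := by
  classical
  let m := (U ∪ U').sup id
  have hm : ∀ j, j ∈ U ∪ U' → j ≤ m := fun j hj => Finset.le_sup (f := id) hj
  have hcard : Fintype.card {x : Finset.Icc (N + 1) m // x.1 ∈ U} =
      Fintype.card {x : Finset.Icc (N + 1) m // x.1 ∈ U'} := by
    have key : ∀ V : Finset ℕ, (∀ j ∈ V, 1 ≤ j) → (∀ j ∈ V, j ≤ m) → Finset.Icc 1 N ⊆ V →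
        Fintype.card {x : Finset.Icc (N + 1) m // x.1 ∈ V} + N = V.card := by
      intro V h1 h2 h3
      have h4 : Fintype.card {x : Finset.Icc (N + 1) m // x.1 ∈ V} = (V \ Finset.Icc 1 N).card := by
        rw [← Fintype.card_coe]
        refine Fintype.card_congr
          { toFun := fun x => ⟨x.1.1, ?_⟩
            invFun := fun x => ⟨⟨x.1, ?_⟩, ?_⟩
            left_inv := fun x => rfl
            right_inv := fun x => rfl }
        · have := Finset.mem_Icc.1 x.1.2
          rw [Finset.mem_sdiff, Finset.mem_Icc]
          exact ⟨x.2, by omega⟩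
        · have := x.2
          rw [Finset.mem_sdiff, Finset.mem_Icc] at this
          rw [Finset.mem_Icc]
          have := h1 _ this.1
          have := h2 x.1 (by tauto)
          omega
        · exact (Finset.mem_sdiff.1 x.2).1
      have h5 := Finset.card_sdiff_add_card_eq_card h3
      rw [Nat.card_Icc] at h5
      omega
    have h1 := key U hU (fun j hj => hm j (Finset.mem_union_left _ hj)) h
    have h2 := key U' hU' (fun j hj => hm j (Finset.mem_union_right _ hj)) h'
    omega
  -- Both sets contain `{1, …, N}`, so their parts beyond `N` have equal size, and a bijection
  -- between those parts extends to a permutation of `{N + 1, …, m}`.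
  let τ := (Fintype.equivOfCardEq hcard).extendSubtype
  let σ : Equiv.Perm ℕ := Equiv.Perm.ofSubtype (p := (· ∈ Finset.Icc (N + 1) m)) τ
  have hfix : ∀ j, ¬ (N + 1 ≤ j ∧ j ≤ m) → σ j = j := fun j hj =>
    Equiv.Perm.ofSubtype_apply_of_not_mem _ (by rwa [Finset.mem_Icc])
  obtain ⟨g, hg⟩ := exists_theta_eq (n := m) (σ := σ) fun j hj => hfix j (by omega)
  refine ⟨m, g, fun j hj => by rw [hg]; exact hfix j (by omega), fun j => ?_⟩
  rw [hg]
  by_cases hj : N + 1 ≤ j ∧ j ≤ m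
  · have e : σ j = τ ⟨j, Finset.mem_Icc.2 hj⟩ :=
      Equiv.Perm.ofSubtype_apply_of_mem (p := (· ∈ Finset.Icc (N + 1) m)) τ (Finset.mem_Icc.2 hj)
    rw [e]
    constructor
    · intro h1
      by_contra h2
      exact Equiv.extendSubtype_not_mem (Fintype.equivOfCardEq hcard) ⟨j, Finset.mem_Icc.2 hj⟩ h2 h1
    · intro h1
      exact Equiv.extendSubtype_mem (Fintype.equivOfCardEq hcard) ⟨j, Finset.mem_Icc.2 hj⟩ h1
  · rw [hfix j hj]
    by_cases h1 : 1 ≤ j ∧ j ≤ N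
    · exact ⟨fun _ => h (Finset.mem_Icc.2 h1), fun _ => h' (Finset.mem_Icc.2 h1)⟩
    · constructor
      · intro h2
        have := hU' j h2
        have := hm j (Finset.mem_union_right _ h2)
        omega
      · intro h2
        have := hU j h2
        have := hm j (Finset.mem_union_left _ h2)
        omega

/-- The supports are disjoint, and evenness of `e` removes the sign in the superalgebra rule,
whatever the parity of `g`. -/
theorem commute_of_theta {N m : ℕ} {e : Cover N} {g : Cover m} (he : parity N e = 1)
    (hg : ∀ j, j ≤ N → theta m g j = j) :
    emb (le_top : (m : ℕ∞) ≤ ⊤) g * emb (le_top : (N : ℕ∞) ≤ ⊤) e =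
      emb (le_top : (N : ℕ∞) ≤ ⊤) e * emb (le_top : (m : ℕ∞) ≤ ⊤) g := by
  have hn : (N : ℕ∞) ≤ (max N m : ℕ) := by exact_mod_cast le_max_left N m
  have hm : (m : ℕ∞) ≤ (max N m : ℕ) := by exact_mod_cast le_max_right N m
  have hpar : parity _ (emb hn e) = 1 := by
    rw [parity_eq_one_iff] at he ⊢
    rw [Equiv.Perm.sign_of_cycleType, cycleType_perm_emb, ← Equiv.Perm.sign_of_cycleType, he]
  have hd : (perm _ (emb hm g)).Disjoint (perm _ (emb hn e)) := by
    intro i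
    have h1 := theta_apply (emb hm g) i
    have h2 := theta_apply (emb hn e) i
    rw [theta_emb] at h1 h2
    by_cases hi : (i : ℕ) + 1 ≤ N
    · left
      rw [hg _ hi] at h1
      exact Fin.ext (by omega)
    · right
      rw [theta_apply_of_not e (by omega)] at h2
      exact Fin.ext (by omega)
  have := superComm_of_disjoint hd
  rw [SuperComm, if_pos (Or.inr hpar), one_mul] at this
  rw [← emb_emb hm le_top, ← emb_emb hn le_top, ← map_mul, this, map_mul]

/-- Conjugation by a lift of a permutation taking `U` to `U'` and fixing `1, …, N` preserves the
classes and `e`, and carries the moved set to `U'`. -/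
theorem ncard_factorizations_le {N : ℕ} {la mu : EvenPartition} {e : Cover N} (he : parity N e = 1)
    {U U' : Finset ℕ} (hU : ∀ j ∈ U, 1 ≤ j) (hU' : ∀ j ∈ U', 1 ≤ j)
    (h : Finset.Icc 1 N ⊆ U) (h' : Finset.Icc 1 N ⊆ U') (hc : U.card = U'.card) :
    (factorizations la mu (emb le_top e) U).ncard ≤ (factorizations la mu (emb le_top e) U').ncard := by
  obtain ⟨m, g, hg, hgU⟩ := exists_perm_image hU hU' h h' hc
  have hcom := commute_of_theta he hg
  set G := emb (le_top : (m : ℕ∞) ≤ ⊤) g with hG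
  refine Set.ncard_le_ncard_of_injOn (fun p => (G * p.1 * G⁻¹, G * p.2 * G⁻¹)) ?_ ?_
    (finite_factorizations _ _ _ _)
  · rintro ⟨a, b⟩ ⟨ha, hb, hab, hm⟩
    refine ⟨DInf_conj G ha, DInf_conj G hb, ?_, ?_⟩
    · simp only at hab ⊢
      rw [show G * a * G⁻¹ * (G * b * G⁻¹) = G * (a * b) * G⁻¹ by group, hab, hcom,
        mul_inv_cancel_right]
    · simp only at hm ⊢
      have hin : ∀ i, i ∈ moved a b ↔ theta m g i ∈ U' := by
        intro i; rw [hm, hgU]; rfl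
      ext j
      obtain ⟨i, rfl⟩ := (theta m g).surjective j
      rw [Finset.mem_coe, ← hin]
      have hθ : theta ⊤ G = theta m g := theta_emb _ g
      simp [moved, hθ]
  · rintro ⟨a, b⟩ _ ⟨a', b'⟩ _ h
    simpa using h

theorem ncard_factorizations_eq {N : ℕ} {la mu : EvenPartition} {e : Cover N} (he : parity N e = 1)
    {U U' : Finset ℕ} (hU : ∀ j ∈ U, 1 ≤ j) (hU' : ∀ j ∈ U', 1 ≤ j)
    (h : Finset.Icc 1 N ⊆ U) (h' : Finset.Icc 1 N ⊆ U') (hc : U.card = U'.card) :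
    (factorizations la mu (emb le_top e) U).ncard = (factorizations la mu (emb le_top e) U').ncard :=
  le_antisymm (ncard_factorizations_le he hU hU' h h' hc)
    (ncard_factorizations_le he hU' hU h' h hc.symm)

/-- Since `e` moves `1, …, N`, every moved set that contributes is `{1, …, N}` together with some `V
⊆ {N + 1, …, n}`, and only the size `k` of `V` matters. -/
theorem count_eq_choose {N n : ℕ} (hn : (N : ℕ∞) ≤ n) (la mu : EvenPartition) {e : Cover N}
    (he : parity N e = 1) (hmov : ∀ i, perm N e i ≠ i) :
    count n la mu (emb hn e) = ∑ k ∈ Finset.range (n - N + 1),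
      (n - N).choose k * (factorizations la mu (emb le_top e) (Finset.Icc 1 (N + k))).ncard := by
  classical
  have hNn : N ≤ n := by exact_mod_cast hn
  let F : Finset ℕ → ℕ := fun U => (factorizations la mu (emb le_top e) U).ncard
  have hzero : ∀ U : Finset ℕ, ¬ Finset.Icc 1 N ⊆ U → F U = 0 := by
    intro U hU
    have : factorizations la mu (emb le_top e) U = ∅ := by
      rw [Set.eq_empty_iff_forall_notMem]
      rintro ⟨a, b⟩ ⟨-, -, hab, hm⟩
      apply hU
      intro j hj
      rw [Finset.mem_Icc] at hj
      rw [← Finset.mem_coe, ← hm]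
      apply moved_mul_subset
      simp only at hab
      rw [hab, theta_emb]
      have h1 := theta_apply e ⟨j - 1, by omega⟩
      have h2 := hmov ⟨j - 1, by omega⟩
      rw [Ne, Fin.ext_iff] at h2
      simp only [Nat.sub_add_cancel hj.1] at h1 h2
      omega
    simp only [F, this, Set.ncard_empty]
  have hdisj : ∀ V ∈ (Finset.Icc (N + 1) n).powerset, ∀ j ∈ V, N < j ∧ j ≤ n := by
    intro V hV j hj
    have := Finset.mem_Icc.1 (Finset.mem_powerset.1 hV hj)
    omega
  rw [count_eq_sum, emb_emb]
  have h1 : ∑ U ∈ (Finset.Icc 1 n).powerset, F U =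
      ∑ U ∈ (Finset.Icc (N + 1) n).powerset.image (Finset.Icc 1 N ∪ ·), F U := by
    symm
    apply Finset.sum_subset
    · intro U hU
      obtain ⟨V, hV, rfl⟩ := Finset.mem_image.1 hU
      rw [Finset.mem_powerset]
      intro j hj
      rw [Finset.mem_union, Finset.mem_Icc] at hj
      rw [Finset.mem_Icc]
      rcases hj with hj | hj
      · omega
      · have := hdisj V hV j hj; omega
    · intro U hU hU'
      apply hzero
      intro hsub
      apply hU'
      rw [Finset.mem_image]
      refine ⟨U \ Finset.Icc 1 N, ?_, Finset.union_sdiff_of_subset hsub⟩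
      rw [Finset.mem_powerset]
      intro j hj
      rw [Finset.mem_sdiff, Finset.mem_Icc] at hj
      have := Finset.mem_Icc.1 (Finset.mem_powerset.1 hU hj.1)
      rw [Finset.mem_Icc]
      omega
  refine h1.trans ?_
  rw [Finset.sum_image]
  · have h2 : ∀ V ∈ (Finset.Icc (N + 1) n).powerset,
        F (Finset.Icc 1 N ∪ V) = F (Finset.Icc 1 (N + V.card)) := by
      intro V hV
      have hd : Disjoint (Finset.Icc 1 N) V := by
        rw [Finset.disjoint_left]
        intro j hj hj'
        rw [Finset.mem_Icc] at hj
        have := hdisj V hV j hj'; omega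
      refine ncard_factorizations_eq he ?_ ?_ Finset.subset_union_left ?_ ?_
      · intro j hj
        rw [Finset.mem_union, Finset.mem_Icc] at hj
        rcases hj with hj | hj
        · exact hj.1
        · have := hdisj V hV j hj; omega
      · intro j hj; exact (Finset.mem_Icc.1 hj).1
      · exact Finset.Icc_subset_Icc_right (by omega)
      · rw [Finset.card_union_of_disjoint hd, Nat.card_Icc, Nat.card_Icc]; omega
    rw [Finset.sum_congr rfl h2, Finset.sum_powerset_apply_card (fun k => F (Finset.Icc 1 (N + k))),
      Nat.card_Icc]
    simp only [smul_eq_mul, F]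
    rw [show n + 1 - (N + 1) = n - N by omega]
  · intro V hV V' hV' h
    simp only at h
    have key : ∀ V ∈ (Finset.Icc (N + 1) n).powerset, ∀ V' : Finset ℕ,
        Finset.Icc 1 N ∪ V = Finset.Icc 1 N ∪ V' → V ⊆ V' := by
      intro V hV V' h j hj
      have h3 : j ∈ Finset.Icc 1 N ∪ V' := by rw [← h]; exact Finset.mem_union_right _ hj
      have := hdisj V hV j hj
      rw [Finset.mem_union, Finset.mem_Icc] at h3
      rcases h3 with h3 | h3
      · omega
      · exact h3
    exact Finset.Subset.antisymm (key V hV V' h) (key V' hV' V h.symm)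

/-! ## Bounds for factorizations -/

theorem typ_rank {n : ℕ} {la : EvenPartition} {g : Cover n} (h : (perm n g).cycleType = la.typ) :
    (perm n g).cycleType.sum = la.size + Multiset.card (perm n g).cycleType := by
  rw [h, la.typ_sum, la.typ_card]

/-- The supports of `a` and `b` cover `m` points, which bounds `m`; subadditivity of rank bounds
`|nu|`. In the equality case the point `N + 1`, if at most `m`, would be fixed by `a b`, hence by
both factors, although one of them moves it. -/
theorem factorization_bounds {N m : ℕ} {la mu nu : EvenPartition} {e : Cover N} (hNm : N ≤ m)
    (he : (perm N e).cycleType = nu.typ)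
    (hne : (factorizations la mu (emb le_top e) (Finset.Icc 1 m)).Nonempty) :
    m ≤ la.degree + mu.degree ∧ nu.size ≤ la.size + mu.size ∧
      (nu.size = la.size + mu.size → m ≤ N) := by
  obtain ⟨⟨a, b⟩, ha, hb, hab, hm⟩ := hne
  simp only at ha hb hab hm
  obtain ⟨a, b, rfl, rfl⟩ := exists_of_moved (hm.subset)
  have hN : (N : ℕ∞) ≤ m := by exact_mod_cast hNm
  rw [emb_mem_DInf, mem_D_iff] at ha hb
  have hab' : a * b = emb hN e := emb_injective le_top (by rw [map_mul, hab, emb_emb])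
  have hmov : ∀ i, perm m a i ≠ i ∨ perm m b i ≠ i := by
    intro i
    have h1 : (i : ℕ) + 1 ∈ moved (emb le_top a) (emb le_top b) := by
      rw [hm, Finset.mem_coe, Finset.mem_Icc]; omega
    simp only [moved, Set.mem_ofPred_eq, theta_emb, theta_apply, Ne, Nat.add_right_cancel_iff] at h1
    simpa [Fin.ext_iff] using h1
  have hr := rank_mul_le (perm m a) (perm m b) (typ_rank ha.1) (typ_rank hb.1) (c := nu.size) (by
    rw [← map_mul, hab']
    exact typ_rank (by rw [cycleType_perm_emb, he]))
  refine ⟨?_, hr.1, fun h => ?_⟩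
  · have h1 : (Finset.univ : Finset (Fin m)) ⊆ (perm m a).support ∪ (perm m b).support := by
      intro i _
      rw [Finset.mem_union, Equiv.Perm.mem_support, Equiv.Perm.mem_support]
      exact hmov i
    have h2 := (Finset.card_le_card h1).trans (Finset.card_union_le _ _)
    rw [Finset.card_fin, ← Equiv.Perm.sum_cycleType, ← Equiv.Perm.sum_cycleType, ha.1, hb.1,
      la.typ_sum, mu.typ_sum] at h2
    exact h2
  · by_contra hlt
    push Not at hlt
    have h1 : perm m (a * b) ⟨N, hlt⟩ = ⟨N, hlt⟩ := by
      have h2 := theta_apply (emb hN e) ⟨N, hlt⟩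
      rw [theta_emb, theta_apply_of_not e (by simp)] at h2
      rw [hab']
      apply Fin.ext
      simp only at h2 ⊢
      omega
    rw [map_mul, Equiv.Perm.mul_apply] at h1
    have h3 := hr.2 h _ h1
    exact (hmov ⟨N, hlt⟩).elim (fun h => h h3.1) (fun h => h h3.2)

/-! ## Polynomials -/

/-- The polynomial whose value at `n ≥ N` is the binomial coefficient of `n - N` and `k`. -/
noncomputable def shiftedChoose (N k : ℕ) : ℚ[X] :=
  C ((k.factorial : ℚ)⁻¹) * (descPochhammer ℚ k).comp (X - C (N : ℚ))

theorem eval_shiftedChoose {N n : ℕ} (h : N ≤ n) (k : ℕ) :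
    (shiftedChoose N k).eval (n : ℚ) = ((n - N).choose k : ℚ) := by
  rw [shiftedChoose, eval_mul, eval_C, eval_comp, eval_sub, eval_X, eval_C, ← Nat.cast_sub h,
    descPochhammer_eval_eq_descFactorial, Nat.descFactorial_eq_factorial_mul_choose]
  push_cast
  rw [inv_mul_cancel_left₀]
  exact_mod_cast k.factorial_ne_zero

theorem natDegree_shiftedChoose_le (N k : ℕ) : (shiftedChoose N k).natDegree ≤ k := by
  refine (natDegree_C_mul_le _ _).trans (natDegree_comp_le.trans ?_)
  rw [descPochhammer_natDegree, natDegree_X_sub_C, mul_one]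

theorem shiftedChoose_zero (N : ℕ) : shiftedChoose N 0 = 1 := by simp [shiftedChoose]

theorem eq_of_eval_nat {f g : ℚ[X]} {N : ℕ}
    (h : ∀ n : ℕ, N ≤ n → f.eval (n : ℚ) = g.eval (n : ℚ)) : f = g := by
  refine Polynomial.eq_of_infinite_eval_eq f g ?_
  refine Set.Infinite.mono (s := Nat.cast '' Set.Ici N) ?_ ?_
  · rintro _ ⟨n, hn, rfl⟩
    exact h n hn
  · exact (Set.Ici_infinite N).image Nat.cast_injective.injOn

/-! ### The structure constants as polynomials in `n` -/

theorem perm_apply_ne_of_full {n : ℕ} {g : Cover n} (h : (perm n g).cycleType.sum = n) (i : Fin n) :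
    perm n g i ≠ i := by
  rw [Equiv.Perm.sum_cycleType] at h
  have := Finset.eq_univ_of_card _ (h.trans (Fintype.card_fin n).symm)
  rw [← Equiv.Perm.mem_support, this]
  exact Finset.mem_univ i

/-- The signed number of factorizations of `c`, and of `z c`, for which the moved points are
`1, …, N + k`. -/
noncomputable def weight (la mu : EvenPartition) {N : ℕ} (c : Cover N) (k : ℕ) : ℤ :=
  ((factorizations la mu (emb le_top c) (Finset.Icc 1 (N + k))).ncard : ℤ) -
    (factorizations la mu (emb le_top (z N * c)) (Finset.Icc 1 (N + k))).ncard

theorem exists_of_weight_ne_zero {la mu : EvenPartition} {N : ℕ} {c : Cover N} {k : ℕ}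
    (h : weight la mu c k ≠ 0) : ∃ e, (e = c ∨ e = z N * c) ∧
      (factorizations la mu (emb le_top e) (Finset.Icc 1 (N + k))).Nonempty := by
  by_contra! hc
  apply h
  rw [weight, hc c (Or.inl rfl), hc _ (Or.inr rfl), sub_self]

theorem structureConst_eq_sum {la mu nu : EvenPartition} {N : ℕ} {c : Cover N} (hc : c ∈ D N nu)
    (hN : nu.size + nu.length = N) {n : ℕ} (hn : N ≤ n) :
    structureConst la mu nu n = ∑ k ∈ Finset.range (la.degree + mu.degree + 1),
      ((n - N).choose k : ℤ) * weight la mu c k := by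
  have hn' : (N : ℕ∞) ≤ n := by exact_mod_cast hn
  have htyp : (perm N c).cycleType = nu.typ := (mem_D_iff.1 hc).1
  have hpar := parity_of_mem_D hc
  have hmov := perm_apply_ne_of_full (g := c) (by rw [htyp, nu.typ_sum, hN])
  rw [structureConst_eq ((emb_mem_D hn').2 hc), ← emb_z hn', ← map_mul,
    count_eq_choose hn' la mu hpar hmov,
    count_eq_choose hn' la mu (e := z N * c) (by rw [map_mul, hpar, parity_z, one_mul])
      (by simpa using hmov)]
  push_cast
  rw [← Finset.sum_sub_distrib]
  have h1 : ∀ k, ((n - N).choose k : ℤ) *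
      ((factorizations la mu (emb le_top c) (Finset.Icc 1 (N + k))).ncard : ℤ) -
      ((n - N).choose k : ℤ) *
        (factorizations la mu (emb le_top (z N * c)) (Finset.Icc 1 (N + k))).ncard =
      ((n - N).choose k : ℤ) * weight la mu c k := fun k => by rw [weight]; ring
  simp only [h1]
  -- The summation range is made independent of `n` by passing through the larger range: extra terms
  -- vanish through the binomial coefficient on one side and through the weight on the other.
  rw [Finset.sum_subset (Finset.range_mono (le_max_left (n - N + 1) (la.degree + mu.degree + 1))),
    Finset.sum_subset (Finset.range_mono (le_max_right (n - N + 1) (la.degree + mu.degree + 1)))]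
  · intro k _ hk
    by_contra h
    obtain ⟨e, he, hne⟩ := exists_of_weight_ne_zero (right_ne_zero_of_mul h)
    have := (factorization_bounds (nu := nu) (by omega)
      (by rcases he with rfl | rfl <;> simp [htyp]) hne).1
    rw [Finset.mem_range] at hk
    omega
  · intro k _ hk
    rw [Finset.mem_range] at hk
    rw [Nat.choose_eq_zero_of_lt (by omega)]
    simp

theorem exists_structurePolynomial (la mu nu : EvenPartition) :
    ∃ f : ℚ[X],
      (∀ n : ℕ, nu.size + nu.length ≤ n → (structureConst la mu nu n : ℚ) = f.eval (n : ℚ)) ∧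
      (∀ g : ℚ[X], (∀ n : ℕ, nu.size + nu.length ≤ n →
        (structureConst la mu nu n : ℚ) = g.eval (n : ℚ)) → g = f) ∧
      (f ≠ 0 → ∃ p ∈ pairs la mu nu,
        f.natDegree + (nu.size + nu.length) ≤ (moved p.1 p.2).ncard) ∧
      (¬ nu.size ≤ la.size + mu.size → f = 0) ∧
      (nu.size = la.size + mu.size → ∃ c : ℤ, f = C (c : ℚ) ∧
        ∀ n : ℕ, nu.size + nu.length ≤ n → structureConst la mu nu n = c) := by
  obtain ⟨N, hN⟩ : ∃ N, nu.size + nu.length = N := ⟨_, rfl⟩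
  obtain ⟨c, hc⟩ := D_nonempty.2 hN.le
  have htyp : (perm N c).cycleType = nu.typ := (mem_D_iff.1 hc).1
  have hbounds : ∀ k, weight la mu c k ≠ 0 → nu.size ≤ la.size + mu.size ∧
      (nu.size = la.size + mu.size → k = 0) := by
    intro k hk
    obtain ⟨e, he, hne⟩ := exists_of_weight_ne_zero hk
    have := factorization_bounds (nu := nu) (by omega)
      (by rcases he with rfl | rfl <;> simp [htyp]) hne
    exact ⟨this.2.1, fun h => by have := this.2.2 h; omega⟩
  let f : ℚ[X] := ∑ k ∈ Finset.range (la.degree + mu.degree + 1),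
    C (weight la mu c k : ℚ) * shiftedChoose N k
  have hf : ∀ n : ℕ, N ≤ n → (structureConst la mu nu n : ℚ) = f.eval (n : ℚ) := by
    intro n hn
    rw [structureConst_eq_sum hc hN hn, eval_finsetSum]
    push_cast
    refine Finset.sum_congr rfl fun k _ => ?_
    rw [eval_mul, eval_C, eval_shiftedChoose hn, mul_comm]
  rw [hN]
  refine ⟨f, hf, fun g hg => eq_of_eval_nat (N := N) fun n hn => (hg n hn).symm.trans (hf n hn),
    fun hf0 => ?_, fun h => ?_, fun h => ?_⟩
  -- Otherwise every surviving summand would have degree below `f.natDegree`. Degree zero is treated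
  -- apart because `f.natDegree - 1` truncates there; in that case no summand survives.
  · obtain ⟨k, hk, hdeg⟩ : ∃ k, weight la mu c k ≠ 0 ∧ f.natDegree ≤ k := by
      by_contra! hcon
      apply hf0
      by_cases h0 : f.natDegree = 0
      · refine Finset.sum_eq_zero fun k _ => ?_
        by_cases hk : weight la mu c k = 0
        · simp [hk]
        · have := hcon k hk; omega
      · have : f.natDegree ≤ f.natDegree - 1 := by
          refine natDegree_sum_le_of_forall_le _ _ fun k _ => ?_
          by_cases hk : weight la mu c k = 0
          · simp [hk]
          · have := hcon k hk
            have := (natDegree_C_mul_le (weight la mu c k : ℚ) (shiftedChoose N k)).trans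
              (natDegree_shiftedChoose_le N k)
            omega
        omega
    obtain ⟨e, he, p, hp⟩ := exists_of_weight_ne_zero hk
    refine ⟨p, ⟨hp.1, hp.2.1, ?_⟩, ?_⟩
    · rw [hp.2.2.1]
      -- A nonzero weight may come from factorizations of `z c` only, hence the alternative `z D_nu`
      -- in `pairs`.
      rcases he with rfl | rfl
      · exact Or.inl (emb_mem_DInf.2 hc)
      · exact Or.inr ⟨emb le_top c, emb_mem_DInf.2 hc, by rw [map_mul, emb_z]⟩
    -- The chosen factorization moves exactly `1, …, N + k`, and `f.natDegree ≤ k`.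
    · rw [hp.2.2.2, Set.ncard_coe_finset, Nat.card_Icc]
      omega
  · refine Finset.sum_eq_zero fun k _ => ?_
    by_cases hk : weight la mu c k = 0
    · simp [hk]
    · exact absurd (hbounds k hk).1 h
  · have hfc : f = C ((weight la mu c 0 : ℤ) : ℚ) := by
      simp only [f]
      rw [Finset.sum_eq_single 0]
      · rw [shiftedChoose_zero, mul_one]
      · intro k _ hk0
        by_cases hk : weight la mu c k = 0
        · simp [hk]
        · exact absurd ((hbounds k hk).2 h) hk0
      · simp
    refine ⟨weight la mu c 0, hfc, fun n hn => ?_⟩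
    have := hf n hn
    rw [hfc, eval_C] at this
    exact_mod_cast this

end SpinFH

theorem mainTheorem5 :
    ∃ a : SpinFH.EvenPartition → SpinFH.EvenPartition → SpinFH.EvenPartition → ℕ → ℤ,
      (∀ (R : Type*) [CommRing R], (∀ r : R, 2 * r = 0 → r = 0) →
        (∀ n : ℕ, SpinFH.ClassSumsFormBasis R n) ∧ SpinFH.IsStructureConstants R a) ∧
      ∀ la mu nu : SpinFH.EvenPartition,
        ∃ f : ℚ[X],
          (∀ n : ℕ, nu.size + nu.length ≤ n → (a la mu nu n : ℚ) = f.eval (n : ℚ)) ∧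
          (∀ g : ℚ[X],
            (∀ n : ℕ, nu.size + nu.length ≤ n → (a la mu nu n : ℚ) = g.eval (n : ℚ)) → g = f) ∧
          (f ≠ 0 → ∃ p ∈ SpinFH.pairs la mu nu,
            f.natDegree + (nu.size + nu.length) ≤ (SpinFH.moved p.1 p.2).ncard) ∧
          (¬ nu.size ≤ la.size + mu.size → f = 0) ∧
          (nu.size = la.size + mu.size →
            ∃ c : ℤ, f = C (c : ℚ) ∧
              ∀ n : ℕ, nu.size + nu.length ≤ n → a la mu nu n = c) := by
  exact ⟨SpinFH.structureConst, fun R _ hR => ⟨fun _ => SpinFH.classSumsFormBasis hR,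
    SpinFH.isStructureConstants hR⟩, SpinFH.exists_structurePolynomial⟩
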